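/- **Setting.** Let $n\ge 2$ agents minimize $f(x)=\frac1n\sum_{i=1}^n f_i(x)$ over $x\in\mathbb{R}^d$, $d\ge1$. $\|\cdot\|$ is the Euclidean norm and $\|\cdot\|_p$ the $\ell_p$-norm, $p\in[1,\infty]$; put $\hat d=d^{1/p-1/2}$, $\tilde d=1$ if $p\le 2$, and $\hat d=1$, $\tilde d=d^{1/2-1/p}$ if $p>2$. *Assumptions.* (i) The compressor $\mathcal C:\mathbb{R}^d\to\mathbb{R}^d$ is locally bounded: $\|\mathcal C(x)/r-x\|_p\le C(1-\delta)$ whenever $\|x\|_p\le C$, where $r,C>0$ and $\delta\in(0,1]$. (ii) The communication graph is undirected and connected, with symmetric nonnegative weight matrix $A$ ($A_{ij}>0$ exactly on edges) and Laplacian $L=\mathrm{diag}(\sum_jA_{ij})-A$; $\rho=\rho(L)$ is its spectral radius and $\rho_2=\rho_2(L)$ its smallest positive eigenvalue. (iii) Each $f_i$ is differentiable with $\|\nabla f_i(x)-\nabla f_i(y)\|\le\ell\|x-y\|$ for all $x,y$, $\ell>0$. (iv) $f^*=\inf f>-\infty$. (v) A number $f_{\rm low}\le f^*$ is given. *Algorithm.*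 With $v_{i,0}=\hat x_{i,-1}=y_{i,-1}=0$ and arbitrary $x_{i,0}$, for $k=0,1,\dots$ $$q_{i,k}=\mathcal C\big((x_{i,k}-\hat x_{i,k-1})/s_k\big),\quad \hat x_{i,k}=\hat x_{i,k-1}+\omega s_kq_{i,k},\quad y_{i,k}=y_{i,k-1}+\omega s_k\sum_jL_{ij}q_{j,k},$$ $$x_{i,k+1}=x_{i,k}-\alpha\big(\beta y_{i,k}+\gamma v_{i,k}+\nabla f_i(x_{i,k})\big),\qquad v_{i,k+1}=v_{i,k}+\alpha\gamma y_{i,k}.$$ Write $\bar x_k=\frac1n\sum_ix_{i,k}$. *Initial Lyapunov value.* Let $J=\frac1n\mathbf 1\mathbf 1^\top$, $E=I-J$, $F=(L+\lambda J)^{-1}$ for some $\lambda\in[\rho_2,\rho]$, and $u_i=\frac1\gamma\nabla f_i(\bar x_0)$. Put, with $\langle a,b\rangle_M=\sum_{i,j}M_{ij}\langle a_i,b_j\rangle$ and $x_0=(x_{i,0})_i$, $$\mathcal L_{1,0}=\tfrac12\langle x_0,x_0\rangle_E+\tfrac{\beta+\gamma}{2\gamma}\langle u,u\rangle_F+\langle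 x_0,u\rangle_{EF}+n\big(f(\bar x_0)-f_{\rm low}\big).$$ *Constants.* With $\beta=\tau_1\gamma$, $\kappa_1=4/\rho_2$, $\kappa_2=\max\{2+2\ell^2,\ 5/\rho_2,\ \sqrt[3]{16\ell^2(\kappa_1+1)^2/\rho_2},\ 2\sqrt2\,\ell/\rho_2\}$, $\varphi_1=\frac12(\rho_2\beta-(3\gamma+2+2\ell^2))$, $\varphi_2=3\rho^2\beta^2-\rho_2\beta\gamma+(\rho+2)\gamma^2+1+\frac52\ell^2$, $\varphi_3=\frac\gamma2-\frac5{2\rho_2}$, $\varphi_4=2\rho\gamma^2+\frac12\rho$, $\varphi_5=\frac18-\frac{(\beta+\gamma)^2\ell^2}{\gamma^5\rho_2}-\frac{\ell^2}{2\gamma^2\rho_2^2}$, $\varphi_6=\frac{(\beta+\gamma)\ell^2}{2\gamma^3\rho_2}+\frac{\ell^2}{2\gamma^2\rho_2^2}+\frac{\ell^2}{2\rho_2^2}+\frac{\ell^2}2+\frac\ell2$, $\varphi_7=(\rho+1)\gamma+\frac12\rho\beta$, $\varphi_8=3\rho^2\beta^2+(\rho-2\rho_2)\beta\gamma+(\rho+2)\gamma^2+1$,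 $\hat\kappa_0=\min\{\varphi_1/\varphi_2,\varphi_3/\varphi_4,\varphi_5/\varphi_6\}$, $\kappa_7=\min\{\hat\kappa_0,1/(2\ell)\}$, $\varepsilon_1=\frac{\tau_1\rho_2-1}{2\tau_1\rho_2}$, $\varepsilon_5=\omega r(\delta-\delta^2/2)$, $\varepsilon_8=(\varepsilon_5+2\varepsilon_5^2)/2$, $\psi_2=\varphi_7+\alpha\varphi_8$, $\psi_3=4(1+\varepsilon_5^{-1})\hat d^2\beta^2\rho^2$, $\psi_4=4(1+\varepsilon_5^{-1})\hat d^2\max\{\beta^2\rho^2+\ell^2,\gamma^2\rho\}/\varepsilon_1$, and, for a fixed $\hat\kappa_3>0$, $$\tilde\kappa_3=\max\Big\{\frac1{n^{1/2}\tilde d^2\kappa_7^2},\ \frac{(1-2\varepsilon_5)\psi_3}{\varepsilon_8}n^{1/2},\ \frac{2\psi_4\mathcal L_{1,0}}{\varepsilon_8C^2s_0^2n}\frac{n^{1/2}}{\tilde d^2},\ \frac{4(1-2\varepsilon_5)^2\psi_2^2\psi_4^2}{\varepsilon_8^2}\frac{n^{1/2}}{\tilde d^2},\ \frac{\hat\kappa_3\tilde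 d^2}{n^{1/2}}\Big\},$$ $$\tilde\kappa_4(T)=\psi_4\mathcal L_{1,0}\alpha^2/C^2+(1-2\varepsilon_5)\psi_2\psi_4n\tilde d^2s_0^2\alpha^3T.$$ *Parameters.* Take $\alpha=\frac1{n^{1/4}\tilde d\sqrt T}$, $\beta=\tau_1\gamma$, $\tau_1\ge\kappa_1$, $\gamma>\kappa_2$, $\hat\kappa_0>0$ (automatic if $\tau_1=\kappa_1$), $\omega\in(0,1/r]$, $s_0>0$ with $s_0\ge\max_i\|x_{i,0}\|_p/C$, an integer $T>\tilde\kappa_3$, and $s_k>0$ with $s_k^2=(1-\varepsilon_8)s_{k-1}^2+\tilde\kappa_4(T)$ for $k\ge1$. **Theorem.** Under these assumptions $$\frac1T\sum_{k=0}^{T-1}\Big(\|\nabla f(\bar x_k)\|^2+\frac1n\sum_{i=1}^n\|x_{i,k}-\bar x_k\|^2\Big)=\mathcal O\Big(\frac{n^{1/4}\tilde d}{\sqrt T}\Big),\qquad f(\bar x_T)-f^*=\mathcal O(1).$$ The constants hidden in $\mathcal O$ depend only on $\ell,\rho(L),\rho_2(L),\hat d,r,\delta,C,\omega,\tau_1,\gamma,s_0,\hat\kappa_3$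 and an upper bound $B$ of $\mathcal L_{1,0}/n$; in particular they are uniform in $T$, $n$, $\tilde d$, the graph, the costs, the compressor and the initial point. -/

import Mathlib

open scoped ENNReal

noncomputable section

namespace DistOpt

/-- `ℝ^d` with the Euclidean norm. -/
abbrev Vec (d : ℕ) := EuclideanSpace ℝ (Fin d)

/-- The `ℓ_p`-norm of a vector of `ℝ^d`, for `p ∈ [1, ∞]`. -/
def lpNorm {d : ℕ} (p : ℝ≥0∞) (x : Vec d) : ℝ :=
  ‖(WithLp.toLp p (fun j => x j) : PiLp p (fun _ : Fin d => ℝ))‖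

/-- `d̂`: the constant in `‖x‖_p ≤ d̂ ‖x‖`, i.e. `d^(1/p - 1/2)` for `p ≤ 2` and `1` for `p > 2`. -/
def dHat (p : ℝ≥0∞) (d : ℕ) : ℝ :=
  if p ≤ 2 then (d : ℝ) ^ ((p⁻¹).toReal - 1 / 2) else 1

/-- `d̃`: the constant in `‖x‖ ≤ d̃ ‖x‖_p`, i.e. `1` for `p ≤ 2` and `d^(1/2 - 1/p)` for `p > 2`
(with `1/∞ = 0`). -/
def dTilde (p : ℝ≥0∞) (d : ℕ) : ℝ :=
  if p ≤ 2 then 1 else (d : ℝ) ^ (1 / 2 - (p⁻¹).toReal)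

/-- A locally-bounded compressor. -/
def IsLocallyBounded {d : ℕ} (p : ℝ≥0∞) (r C δ : ℝ) (Cmp : Vec d → Vec d) : Prop :=
  ∀ x : Vec d, lpNorm p x ≤ C → lpNorm p (r⁻¹ • Cmp x - x) ≤ C * (1 - δ)

/-! ### Communication graph -/

/-- `A` is the weighted adjacency matrix of an undirected connected graph on `n` agents; the edges
are the pairs of agents with positive weight (self-loops are allowed and irrelevant). -/
structure IsUndirectedConnected {n : ℕ} (A : Matrix (Fin n) (Fin n) ℝ) : Prop where
  nonneg : ∀ i j, 0 ≤ A i j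
  symm : ∀ i j, A i j = A j i
  connected : (SimpleGraph.fromRel (fun i j => 0 < A i j)).Connected

/-- The Laplacian `L = D - A`. -/
def laplacian {n : ℕ} (A : Matrix (Fin n) (Fin n) ℝ) : Matrix (Fin n) (Fin n) ℝ :=
  Matrix.diagonal (fun i => ∑ j, A i j) - A

/-- The spectral radius `ρ(L)`. -/
def rhoMax {n : ℕ} (L : Matrix (Fin n) (Fin n) ℝ) : ℝ := (spectralRadius ℝ L).toReal

/-- The smallest positive eigenvalue `ρ₂(L)`. -/
def rhoTwo {n : ℕ} (L : Matrix (Fin n) (Fin n) ℝ) : ℝ := sInf {μ : ℝ | μ ∈ spectrum ℝ L ∧ 0 < μ}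

/-- The averaging matrix `(1/n) 1 1ᵀ`. -/
def avgMat (n : ℕ) : Matrix (Fin n) (Fin n) ℝ := Matrix.of fun _ _ => (1 : ℝ) / n

/-- `E = I - (1/n) 1 1ᵀ`. -/
def matE (n : ℕ) : Matrix (Fin n) (Fin n) ℝ := 1 - avgMat n

/-- `F`: if `L = [q Q] diag(0, Λ₁) [q Q]ᵀ` with `q = 1/√n`, then
`F = [q Q] diag(lam⁻¹, Λ₁⁻¹) [q Q]ᵀ`, which is the inverse of `L + lam • q qᵀ`. -/
def matF {n : ℕ} (L : Matrix (Fin n) (Fin n) ℝ) (lam : ℝ) : Matrix (Fin n) (Fin n) ℝ :=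
  (L + lam • avgMat n)⁻¹

/-! ### Cost functions -/

/-- `f = (1/n) ∑ f_i`. -/
def globalCost {n d : ℕ} (f : Fin n → Vec d → ℝ) (x : Vec d) : ℝ := (1 / (n : ℝ)) * ∑ i, f i x

/-- `g` is differentiable with `ℓ`-Lipschitz gradient. -/
def IsSmoothCost {d : ℕ} (ell : ℝ) (g : Vec d → ℝ) : Prop :=
  Differentiable ℝ g ∧ ∀ x y, ‖gradient g x - gradient g y‖ ≤ ell * ‖x - y‖

/-- The average `x̄` of the agents' vectors. -/
def mean {n d : ℕ} (x : Fin n → Vec d) : Vec d := (1 / (n : ℝ)) • ∑ i, x i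

/-! ### The unified compression algorithm -/

/-- At time `k`: `x = x_k`, `v = v_k`, `xhat = x̂_{k-1}`, `y = y_{k-1}`. -/
structure AlgState (n d : ℕ) where
  x : Fin n → Vec d
  v : Fin n → Vec d
  xhat : Fin n → Vec d
  y : Fin n → Vec d

/-- The transmitted vector `q_i = Cmp ((x_{i,k} - x̂_{i,k-1}) / s_k)`. -/
def compressed {n d : ℕ} (Cmp : Vec d → Vec d) (s : ℝ) (S : AlgState n d) (i : Fin n) : Vec d :=
  Cmp (s⁻¹ • (S.x i - S.xhat i))

/-- `x̂_{i,k} = x̂_{i,k-1} + ω s_k q_{i,k}`. -/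
def nextXhat {n d : ℕ} (Cmp : Vec d → Vec d) (ω s : ℝ) (S : AlgState n d) (i : Fin n) : Vec d :=
  S.xhat i + (ω * s) • compressed Cmp s S i

/-- `y_{i,k} = y_{i,k-1} + ω s_k ∑_j L_{ij} q_{j,k}`. -/
def nextY {n d : ℕ} (L : Matrix (Fin n) (Fin n) ℝ) (Cmp : Vec d → Vec d) (ω s : ℝ)
    (S : AlgState n d) (i : Fin n) : Vec d :=
  S.y i + (ω * s) • ∑ j, L i j • compressed Cmp s S j

/-- One iteration of the algorithm with scaling factor `s = s_k`. -/
def algStep {n d : ℕ} (L : Matrix (Fin n) (Fin n) ℝ) (f : Fin n → Vec d → ℝ)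
    (Cmp : Vec d → Vec d) (α β γ ω s : ℝ) (S : AlgState n d) : AlgState n d where
  x := fun i => S.x i - α • (β • nextY L Cmp ω s S i + γ • S.v i + gradient (f i) (S.x i))
  v := fun i => S.v i + (α * γ) • nextY L Cmp ω s S i
  xhat := nextXhat Cmp ω s S
  y := nextY L Cmp ω s S

/-- The run of the algorithm from `x_0`, with `v_0 = x̂_{-1} = y_{-1} = 0`. -/
def algRun {n d : ℕ} (L : Matrix (Fin n) (Fin n) ℝ) (f : Fin n → Vec d → ℝ)
    (Cmp : Vec d → Vec d) (α β γ ω : ℝ) (s : ℕ → ℝ) (x0 : Fin n → Vec d) : ℕ → AlgState n d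
  | 0 => { x := x0, v := fun _ => 0, xhat := fun _ => 0, y := fun _ => 0 }
  | k + 1 => algStep L f Cmp α β γ ω (s k) (algRun L f Cmp α β γ ω s x0 k)

/-! ### The Lyapunov function -/

/-- `xᵀ (M ⊗ I_d) y` for stacked vectors `x`, `y`. -/
def wInner {n d : ℕ} (M : Matrix (Fin n) (Fin n) ℝ) (x y : Fin n → Vec d) : ℝ :=
  ∑ i, ∑ j, M i j * inner ℝ (x i) (y j)

/-- `v + (1/γ) g⁰`, where `g⁰_i = ∇f_i(x̄)`. -/
def shiftedDual {n d : ℕ} (f : Fin n → Vec d → ℝ) (γ : ℝ) (x v : Fin n → Vec d) (i : Fin n) :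
    Vec d :=
  v i + γ⁻¹ • gradient (f i) (mean x)

/-- The Lyapunov function `e₁ + e₂ + e₃ + e₄` at primal variable `x` and dual variable `v`, where
the lower bound `flow` of the optimal value stands for the optimal value in
`e₄ = n f(x̄) - n flow`. -/
def lyapunov {n d : ℕ} (L : Matrix (Fin n) (Fin n) ℝ) (lam : ℝ) (f : Fin n → Vec d → ℝ)
    (β γ flow : ℝ) (x v : Fin n → Vec d) : ℝ :=
  1 / 2 * wInner (matE n) x x
  + 1 / 2 * ((β + γ) / γ) * wInner (matF L lam) (shiftedDual f γ x v) (shiftedDual f γ x v)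
  + wInner (matE n * matF L lam) x (shiftedDual f γ x v)
  + (n * globalCost f (mean x) - n * flow)

/-! ### Explicit constants -/

/-- The scalars on which the constants below depend: the smoothness constant `ℓ`, `ρ(L)`, `ρ₂(L)`,
`d̂`, the compressor parameters `r`, `δ`, `C`, and the algorithm parameters `ω`, `τ₁`, `γ`, `s₀`. -/
structure Params where
  ell : ℝ
  rho : ℝ
  rho2 : ℝ
  dhat : ℝ
  r : ℝ
  δ : ℝ
  C : ℝ
  ω : ℝ
  τ₁ : ℝ
  γ : ℝ
  s₀ : ℝ

namespace Params

variable (P : Params)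

def β : ℝ := P.τ₁ * P.γ

def κ₁ : ℝ := 4 / P.rho2

def κ₂ : ℝ :=
  max (max (2 + 2 * P.ell ^ 2) (5 / P.rho2))
    (max ((16 * P.ell ^ 2 * (P.κ₁ + 1) ^ 2 / P.rho2) ^ (1 / 3 : ℝ))
      (2 * √2 * P.ell / P.rho2))

def φ₁ : ℝ := 1 / 2 * (P.rho2 * P.β - (3 * P.γ + 2 + 2 * P.ell ^ 2))

def φ₂ : ℝ :=
  3 * P.rho ^ 2 * P.β ^ 2 - P.rho2 * P.β * P.γ + (P.rho + 2) * P.γ ^ 2 + 1 + 5 / 2 * P.ell ^ 2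

def φ₃ : ℝ := P.γ / 2 - 5 / 2 * P.rho2⁻¹

def φ₄ : ℝ := 2 * P.rho * P.γ ^ 2 + 1 / 2 * P.rho

def φ₅ : ℝ :=
  1 / 8 - (P.β + P.γ) ^ 2 / P.γ ^ 5 * P.rho2⁻¹ * P.ell ^ 2
    - 1 / (2 * P.γ ^ 2) * (P.rho2⁻¹) ^ 2 * P.ell ^ 2

def φ₆ : ℝ :=
  (P.β + P.γ) / (2 * P.γ ^ 3) * P.rho2⁻¹ * P.ell ^ 2
    + 1 / (2 * P.γ ^ 2) * (P.rho2⁻¹) ^ 2 * P.ell ^ 2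
    + (P.rho2⁻¹) ^ 2 / 2 * P.ell ^ 2 + P.ell ^ 2 / 2 + P.ell / 2

def φ₇ : ℝ := (P.rho + 1) * P.γ + 1 / 2 * P.rho * P.β

def φ₈ : ℝ :=
  3 * P.rho ^ 2 * P.β ^ 2 + (P.rho - 2 * P.rho2) * P.β * P.γ + (P.rho + 2) * P.γ ^ 2 + 1

def ε₁ : ℝ := (P.τ₁ * P.rho2 - 1) / (2 * P.τ₁ * P.rho2)

def ε₅ : ℝ := P.ω * P.r * (P.δ - P.δ ^ 2 / 2)

def ε₈ : ℝ := (P.ε₅ + 2 * P.ε₅ ^ 2) / 2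

def κhat₀ : ℝ := min (P.φ₁ / P.φ₂) (min (P.φ₃ / P.φ₄) (P.φ₅ / P.φ₆))

def κ₇ : ℝ := min P.κhat₀ (1 / (2 * P.ell))

def ψ₂ (α : ℝ) : ℝ := P.φ₇ + α * P.φ₈

def ψ₃ : ℝ := 4 * (1 + P.ε₅⁻¹) * P.dhat ^ 2 * P.β ^ 2 * P.rho ^ 2

def ψ₄ : ℝ :=
  4 * (1 + P.ε₅⁻¹) * P.dhat ^ 2
    * max (P.β ^ 2 * P.rho ^ 2 + P.ell ^ 2) (P.γ ^ 2 * P.rho) / P.ε₁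

end Params

/-- The stepsize `α = 1 / (n^{1/4} d̃ √T)`. -/
def stepsize (n : ℕ) (dt : ℝ) (T : ℕ) : ℝ := 1 / ((n : ℝ) ^ (1 / 4 : ℝ) * dt * √(T : ℝ))

namespace Params

variable (P : Params)

/-- The threshold `κ̃₃` for `T`; here `dt = d̃`, `L0 = 𝓛_{1,0}`, and `κhat₃ > 0` is a free constant.
It depends on `T` through the stepsize in `ψ₂`. -/
def κtilde₃ (n : ℕ) (dt κhat₃ L0 : ℝ) (T : ℕ) : ℝ :=
  max (1 / (√(n : ℝ) * dt ^ 2 * P.κ₇ ^ 2))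
    (max ((1 - 2 * P.ε₅) * P.ψ₃ / P.ε₈ * √(n : ℝ))
      (max (2 * P.ψ₄ * L0 / (P.ε₈ * P.C ^ 2 * P.s₀ ^ 2 * n) * (√(n : ℝ) / dt ^ 2))
        (max (4 * (1 - 2 * P.ε₅) ^ 2 * P.ψ₂ (stepsize n dt T) ^ 2 * P.ψ₄ ^ 2 / P.ε₈ ^ 2
            * (√(n : ℝ) / dt ^ 2))
          (κhat₃ * dt ^ 2 / √(n : ℝ)))))

/-- `κ̃₄(T) = ψ₄ 𝓛_{1,0} α² / C² + (1 - 2ε₅) ψ₂ ψ₄ n d̃² s₀² α³ T`. -/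
def κtilde₄ (n : ℕ) (dt L0 : ℝ) (T : ℕ) : ℝ :=
  P.ψ₄ * L0 * stepsize n dt T ^ 2 / P.C ^ 2
    + (1 - 2 * P.ε₅) * P.ψ₂ (stepsize n dt T) * P.ψ₄ * n * dt ^ 2 * P.s₀ ^ 2
      * stepsize n dt T ^ 3 * T

/-- `s_k²`: `s_k² = (1 - ε₈) s_{k-1}² + κ̃₄(T)`. -/
def scalingSq (n : ℕ) (dt L0 : ℝ) (T : ℕ) : ℕ → ℝ
  | 0 => P.s₀ ^ 2
  | k + 1 => (1 - P.ε₈) * scalingSq n dt L0 T k + P.κtilde₄ n dt L0 T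

/-- The scaling factor `s_k > 0`. -/
def scaling (n : ℕ) (dt L0 : ℝ) (T k : ℕ) : ℝ := √(P.scalingSq n dt L0 T k)

end Params

end DistOpt

end

open DistOpt

/-!
The iteration is a compressed primal-dual gradient method. On stacked vectors the Laplacian `L`, the
projection `E` onto the disagreement space and `F = (L + lam (1 - E))⁻¹` are commuting symmetric
operators, and one step of the algorithm lowers the energy
`½‖E x‖² + (β + γ)/(2γ) ⟪w, F w⟫ + ⟪x, E F w⟫` plus the cost gap, up to a multiple of the squared
compression error. That error contracts by the factor `1 - 2ε₅`, up to the length of a step, as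
long as the transmitted vectors stay in the ball where the compressor is bounded. This is an
induction: the energy bounds the length of a step, hence the scaling factors bound the compression
error, and the compression error bounds the growth of the energy. Summing the descent inequality
gives the rate.
-/

namespace DistOpt

/-! ### Operators with the algebra of a graph Laplacian -/

section Energy

open scoped RealInnerProductSpace

lemma norm_sum_sq_le {ι H : Type*} [SeminormedAddCommGroup H] (s : Finset ι) (f : ι → H) :
    ‖∑ i ∈ s, f i‖ ^ 2 ≤ s.card * ∑ i ∈ s, ‖f i‖ ^ 2 :=
  (pow_le_pow_left₀ (norm_nonneg _) (norm_sum_le s f) 2).trans sq_sum_le_card_mul_sum_sq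

variable {H : Type*} [NormedAddCommGroup H]

lemma norm_add_sq_le (a b : H) : ‖a + b‖ ^ 2 ≤ 2 * (‖a‖ ^ 2 + ‖b‖ ^ 2) := by
  simpa using norm_sum_sq_le Finset.univ ![a, b]

lemma norm_add_three_sq_le (a b c : H) :
    ‖a + b + c‖ ^ 2 ≤ 3 * (‖a‖ ^ 2 + ‖b‖ ^ 2 + ‖c‖ ^ 2) := by
  simpa [Fin.sum_univ_three] using norm_sum_sq_le Finset.univ ![a, b, c]

lemma norm_add_four_sq_le (a b c d : H) :
    ‖a + b + c + d‖ ^ 2 ≤ 4 * (‖a‖ ^ 2 + ‖b‖ ^ 2 + ‖c‖ ^ 2 + ‖d‖ ^ 2) := by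
  simpa [Fin.sum_univ_four] using norm_sum_sq_le Finset.univ ![a, b, c, d]

variable [InnerProductSpace ℝ H]

lemma abs_two_mul_inner_le {η : ℝ} (hη : 0 < η) (a b : H) :
    |2 * ⟪a, b⟫| ≤ η * ‖a‖ ^ 2 + η⁻¹ * ‖b‖ ^ 2 :=
  calc |2 * ⟪a, b⟫| = 2 * |⟪a, b⟫| := by rw [abs_mul, abs_two]
    _ ≤ 2 * ‖a‖ * ‖b‖ := by rw [mul_assoc]; gcongr; exact abs_real_inner_le_norm a b
    _ ≤ _ := two_mul_le_add_mul_sq hη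

lemma abs_two_mul_inner_le_of_norm_sq_le {η α K : ℝ} (hη : 0 < η) (hα : 0 < α) (a : H) {b : H}
    (hb : ‖b‖ ^ 2 ≤ α ^ 2 * K) : |2 * ⟪a, b⟫| ≤ α * (η * ‖a‖ ^ 2 + η⁻¹ * K) :=
  calc |2 * ⟪a, b⟫| ≤ α * η * ‖a‖ ^ 2 + (α * η)⁻¹ * ‖b‖ ^ 2 :=
        abs_two_mul_inner_le (mul_pos hα hη) a b
    _ ≤ α * η * ‖a‖ ^ 2 + (α * η)⁻¹ * (α ^ 2 * K) := by gcongr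
    _ = α * (η * ‖a‖ ^ 2 + η⁻¹ * K) := by field_simp

/-- The algebra of a graph Laplacian: `L` is symmetric and behaves like the Laplacian of a connected
graph with nonzero spectrum in `[ρ₂, ρ]`, `E` is the orthogonal projection off the kernel of `L`,
and `F` is the inverse of `L + lam • (1 - E)`. -/
structure IsLaplacianTriple (L E F : H →ₗ[ℝ] H) (ρ₂ ρ lam : ℝ) : Prop where
  L_symm : L.IsSymmetric
  E_symm : E.IsSymmetric
  E_idem : ∀ x, E (E x) = E x
  L_E : ∀ x, L (E x) = L x
  F_leftInv : ∀ x, F (L x + lam • (x - E x)) = x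
  F_rightInv : ∀ x, L (F x) + lam • (F x - E (F x)) = x
  rho2_pos : 0 < ρ₂
  rho2_le : ρ₂ ≤ lam
  le_rho : lam ≤ ρ
  coercive : ∀ x, ρ₂ * ‖E x‖ ^ 2 ≤ ⟪x, L x⟫
  bounded : ∀ x, ‖L x‖ ^ 2 ≤ ρ * ⟪x, L x⟫

/-- The quadratic part of the Lyapunov function at primal variable `x` and shifted dual variable
`w`; the algorithm uses it with `c = (β + γ) / γ`. -/
noncomputable def primalDualEnergy (E F : H →ₗ[ℝ] H) (c : ℝ) (x w : H) : ℝ :=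
  1 / 2 * ‖E x‖ ^ 2 + c / 2 * ⟪w, F w⟫ + ⟪x, E (F w)⟫

namespace IsLaplacianTriple

variable {L E F : H →ₗ[ℝ] H} {ρ₂ ρ lam : ℝ} (T : IsLaplacianTriple L E F ρ₂ ρ lam)
include T

lemma lam_pos : 0 < lam := T.rho2_pos.trans_le T.rho2_le

lemma rho_pos : 0 < ρ := T.lam_pos.trans_le T.le_rho

lemma rho2_le_rho : ρ₂ ≤ ρ := T.rho2_le.trans T.le_rho

lemma E_L (x : H) : E (L x) = L x :=
  ext_inner_right ℝ fun y => by rw [T.E_symm, T.L_symm, T.L_E, T.L_symm]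

lemma F_L (x : H) : F (L x) = E x := by
  simpa only [T.L_E, T.E_idem, sub_self, smul_zero, add_zero] using T.F_leftInv (E x)

lemma L_F (x : H) : L (F x) = E x := by
  simpa only [map_add, map_smul, map_sub, T.E_L, T.E_idem, sub_self, smul_zero, add_zero]
    using congrArg E (T.F_rightInv x)

lemma E_F (x : H) : E (F x) = F (E x) := by
  rw [← T.L_F x, T.F_L]

lemma F_eq (x : H) : F x = E (F x) + lam⁻¹ • (x - E x) := by
  have h : lam • (F x - E (F x)) = x - E x := by
    rw [← T.L_F x, eq_sub_iff_add_eq, add_comm, T.F_rightInv]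
  rw [← h, inv_smul_smul₀ T.lam_pos.ne', add_sub_cancel]

lemma F_symm : F.IsSymmetric := fun x y => by
  conv_lhs => rw [← T.F_rightInv y]
  conv_rhs => rw [← T.F_rightInv x]
  simp only [inner_add_left, inner_add_right, inner_sub_left, inner_sub_right,
    inner_smul_left, inner_smul_right, RCLike.conj_to_real, T.L_symm (F x), T.E_symm (F x)]

lemma inner_E (x : H) : ⟪x, E x⟫ = ‖E x‖ ^ 2 := by
  rw [← real_inner_self_eq_norm_sq, T.E_symm, T.E_idem]

lemma inner_E_comm (x y : H) : ⟪x, E y⟫ = ⟪y, E x⟫ := by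
  rw [← T.E_symm, real_inner_comm]

lemma inner_F_comm (x y : H) : ⟪x, F y⟫ = ⟪y, F x⟫ := by
  rw [← T.F_symm, real_inner_comm]

lemma inner_L_F (x y : H) : ⟪L x, F y⟫ = ⟪y, E x⟫ := by
  rw [T.L_symm, T.L_F, T.inner_E_comm]

lemma inner_L_E (x y : H) : ⟪L x, E y⟫ = ⟪x, L y⟫ := by
  rw [T.L_symm, T.L_E]

lemma norm_sq_eq_add (x : H) : ‖x‖ ^ 2 = ‖E x‖ ^ 2 + ‖x - E x‖ ^ 2 := by
  have h := norm_sub_sq_real x (E x)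
  rw [T.inner_E] at h
  linarith

lemma norm_E_sq_le (x : H) : ‖E x‖ ^ 2 ≤ ‖x‖ ^ 2 := by
  rw [T.norm_sq_eq_add x]
  exact le_add_of_nonneg_right (sq_nonneg _)

lemma norm_sub_E_sq_le (x : H) : ‖x - E x‖ ^ 2 ≤ ‖x‖ ^ 2 := by
  rw [T.norm_sq_eq_add x]
  exact le_add_of_nonneg_left (sq_nonneg _)

lemma inner_L_nonneg (x : H) : 0 ≤ ⟪x, L x⟫ :=
  (mul_nonneg T.rho2_pos.le (sq_nonneg _)).trans (T.coercive x)

lemma norm_L_le (x : H) : ‖L x‖ ≤ ρ * ‖E x‖ := by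
  have hLE : ⟪x, L x⟫ ≤ ‖E x‖ * ‖L x‖ := by
    rw [← T.E_L, ← T.E_symm, T.E_L]
    exact real_inner_le_norm _ _
  have hρ := T.rho_pos
  rcases (norm_nonneg (L x)).eq_or_lt with h0 | hpos
  · rw [← h0]
    positivity
  · refine le_of_mul_le_mul_right ?_ hpos
    calc ‖L x‖ * ‖L x‖ = ‖L x‖ ^ 2 := (sq _).symm
      _ ≤ ρ * ⟪x, L x⟫ := T.bounded x
      _ ≤ ρ * (‖E x‖ * ‖L x‖) := by gcongr
      _ = ρ * ‖E x‖ * ‖L x‖ := by ring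

lemma inner_L_le (x : H) : ⟪x, L x⟫ ≤ ρ * ‖E x‖ ^ 2 :=
  calc ⟪x, L x⟫ = ⟪E x, L x⟫ := by rw [T.E_symm, T.E_L]
    _ ≤ ‖E x‖ * ‖L x‖ := real_inner_le_norm _ _
    _ ≤ ‖E x‖ * (ρ * ‖E x‖) := by gcongr; exact T.norm_L_le x
    _ = ρ * ‖E x‖ ^ 2 := by ring

lemma inner_EF (w : H) : ⟪w, E (F w)⟫ = ⟪E (F w), L (E (F w))⟫ := by
  rw [T.L_E, T.L_F, T.E_symm, T.E_idem, T.F_symm, ← T.E_F]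

lemma inner_EF_nonneg (w : H) : 0 ≤ ⟪w, E (F w)⟫ := by
  rw [T.inner_EF]
  exact T.inner_L_nonneg _

lemma norm_EF_sq_le_inner (w : H) : ‖E (F w)‖ ^ 2 ≤ ρ₂⁻¹ * ⟪w, E (F w)⟫ := by
  have h := T.coercive (E (F w))
  rwa [← T.inner_EF, T.E_idem, ← le_inv_mul_iff₀ T.rho2_pos] at h

lemma norm_E_sq_le_inner (w : H) : ‖E w‖ ^ 2 ≤ ρ * ⟪w, E (F w)⟫ := by
  have h := T.bounded (E (F w))
  rwa [← T.inner_EF, T.L_E, T.L_F] at h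

lemma norm_EF_le (w : H) : ‖E (F w)‖ ≤ ρ₂⁻¹ * ‖E w‖ := by
  have hEF : ⟪w, E (F w)⟫ ≤ ‖E w‖ * ‖E (F w)‖ := by
    rw [← T.E_idem (F w), ← T.E_symm, T.E_idem]
    exact real_inner_le_norm _ _
  have hρ₂ := T.rho2_pos
  rcases (norm_nonneg (E (F w))).eq_or_lt with h0 | hpos
  · rw [← h0]
    positivity
  · refine le_of_mul_le_mul_right ?_ hpos
    calc ‖E (F w)‖ * ‖E (F w)‖ = ‖E (F w)‖ ^ 2 := (sq _).symm
      _ ≤ ρ₂⁻¹ * ⟪w, E (F w)⟫ := T.norm_EF_sq_le_inner w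
      _ ≤ ρ₂⁻¹ * (‖E w‖ * ‖E (F w)‖) := by gcongr
      _ = ρ₂⁻¹ * ‖E w‖ * ‖E (F w)‖ := by ring

lemma norm_EF_sq_le (w : H) : ‖E (F w)‖ ^ 2 ≤ ρ₂⁻¹ ^ 2 * ‖w‖ ^ 2 :=
  calc ‖E (F w)‖ ^ 2 ≤ (ρ₂⁻¹ * ‖E w‖) ^ 2 := by gcongr; exact T.norm_EF_le w
    _ = ρ₂⁻¹ ^ 2 * ‖E w‖ ^ 2 := mul_pow _ _ _
    _ ≤ ρ₂⁻¹ ^ 2 * ‖w‖ ^ 2 := by gcongr ρ₂⁻¹ ^ 2 * ?_; exact T.norm_E_sq_le w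

lemma inner_F (w : H) : ⟪w, F w⟫ = ⟪w, E (F w)⟫ + lam⁻¹ * ‖w - E w‖ ^ 2 := by
  have h : ⟪w, w - E w⟫ = ‖w - E w‖ ^ 2 := by
    rw [inner_sub_right, T.inner_E, real_inner_self_eq_norm_sq, T.norm_sq_eq_add w,
      add_sub_cancel_left]
  conv_lhs => rw [T.F_eq w]
  rw [inner_add_right, inner_smul_right, h]

lemma inner_EF_le_inner_F (w : H) : ⟪w, E (F w)⟫ ≤ ⟪w, F w⟫ := by
  have := T.lam_pos
  rw [T.inner_F w]
  exact le_add_of_nonneg_right (by positivity)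

lemma inner_F_nonneg (w : H) : 0 ≤ ⟪w, F w⟫ :=
  (T.inner_EF_nonneg w).trans (T.inner_EF_le_inner_F w)

lemma inner_F_le (w : H) : ⟪w, F w⟫ ≤ ρ₂⁻¹ * ‖w‖ ^ 2 := by
  have hρ₂ := T.rho2_pos
  have hlam : lam⁻¹ ≤ ρ₂⁻¹ := by gcongr; exact T.rho2_le
  have hEF : ⟪w, E (F w)⟫ ≤ ρ₂⁻¹ * ‖E w‖ ^ 2 :=
    calc ⟪w, E (F w)⟫ = ⟪E w, E (F w)⟫ := by rw [T.E_symm, T.E_idem]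
      _ ≤ ‖E w‖ * ‖E (F w)‖ := real_inner_le_norm _ _
      _ ≤ ‖E w‖ * (ρ₂⁻¹ * ‖E w‖) := by gcongr; exact T.norm_EF_le w
      _ = ρ₂⁻¹ * ‖E w‖ ^ 2 := by ring
  rw [T.inner_F, T.norm_sq_eq_add w, mul_add]
  gcongr

lemma norm_sq_le_inner_F (w : H) : ‖w‖ ^ 2 ≤ ρ * ⟪w, F w⟫ := by
  have hlam : 1 ≤ ρ * lam⁻¹ := by
    rw [← div_eq_mul_inv, one_le_div T.lam_pos]
    exact T.le_rho
  rw [T.inner_F, T.norm_sq_eq_add w, mul_add, ← mul_assoc]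
  exact add_le_add (T.norm_E_sq_le_inner w) (le_mul_of_one_le_left (sq_nonneg _) hlam)

lemma two_mul_inner_F_le {η : ℝ} (hη : 0 < η) (a b : H) :
    2 * ⟪a, F b⟫ ≤ η * ⟪a, F a⟫ + η⁻¹ * ⟪b, F b⟫ := by
  have h := T.inner_F_nonneg (η • a - b)
  simp only [map_sub, map_smul, inner_sub_left, inner_sub_right, inner_smul_left,
    inner_smul_right, T.inner_F_comm b a, RCLike.conj_to_real] at h
  have hid : η * ⟪a, F a⟫ + η⁻¹ * ⟪b, F b⟫ - 2 * ⟪a, F b⟫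
      = η⁻¹ * (η * (η * ⟪a, F a⟫ - ⟪a, F b⟫) - (η * ⟪a, F b⟫ - ⟪b, F b⟫)) := by
    field_simp
    ring
  rw [← sub_nonneg, hid]
  exact mul_nonneg (inv_nonneg.2 hη.le) h

lemma energy_lower_bound {τ : ℝ} (hτ : 0 < τ) (x w : H) :
    (τ * ρ₂ - 1) / (2 * τ * ρ₂) * ‖E x‖ ^ 2 + 1 / 2 * ⟪w, F w⟫
      ≤ primalDualEnergy E F (τ + 1) x w := by
  have hρ₂ := T.rho2_pos
  have hcross : -(2 * ⟪x, E (F w)⟫) ≤ (τ * ρ₂)⁻¹ * ‖E x‖ ^ 2 + τ * ⟪w, F w⟫ := by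
    have h := abs_two_mul_inner_le (η := (τ * ρ₂)⁻¹) (by positivity) (E x) (E (F w))
    rw [T.E_symm, T.E_idem, inv_inv] at h
    calc _ ≤ (τ * ρ₂)⁻¹ * ‖E x‖ ^ 2 + τ * ρ₂ * ‖E (F w)‖ ^ 2 := (neg_le_abs _).trans h
      _ ≤ (τ * ρ₂)⁻¹ * ‖E x‖ ^ 2 + τ * ρ₂ * (ρ₂⁻¹ * ⟪w, F w⟫) := by
        gcongr
        exact (T.norm_EF_sq_le_inner w).trans (by gcongr; exact T.inner_EF_le_inner_F w)
      _ = _ := by field_simp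
  have hcoef : (τ * ρ₂ - 1) / (2 * τ * ρ₂) = 1 / 2 - (τ * ρ₂)⁻¹ / 2 := by
    field_simp
  rw [hcoef, primalDualEnergy]
  linarith

end IsLaplacianTriple

end Energy

/-! ### Descent of the energy along one iteration -/

section EnergyDescent

open scoped RealInnerProductSpace

variable {H : Type*} [NormedAddCommGroup H] [InnerProductSpace ℝ H]

lemma neg_inner_gradient_le {g g₀ : H} {c : ℝ} (h : ‖g - g₀‖ ^ 2 ≤ c) :
    -⟪g, g₀⟫ ≤ -(1 / 8 * ‖g‖ ^ 2) - 1 / 8 * ‖g₀‖ ^ 2 + 5 / 16 * c := by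
  have hadd : 0 ≤ ‖g + g₀‖ ^ 2 := sq_nonneg _
  rw [norm_add_sq_real] at hadd
  rw [norm_sub_sq_real] at h
  linarith

namespace IsLaplacianTriple

variable {L E F : H →ₗ[ℝ] H} {ρ₂ ρ lam : ℝ} (T : IsLaplacianTriple L E F ρ₂ ρ lam)
include T

lemma norm_E_sub_smul_sq (α : ℝ) (x p : H) :
    ‖E (x - α • p)‖ ^ 2 = ‖E x‖ ^ 2 - 2 * α * ⟪x, E p⟫ + α ^ 2 * ‖E p‖ ^ 2 := by
  rw [map_sub, map_smul, norm_sub_sq_real, inner_smul_right, T.E_symm, T.E_idem, norm_smul, mul_pow,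
    Real.norm_eq_abs, sq_abs]
  ring

lemma inner_F_dual_step (w z h : H) (a b : ℝ) :
    ⟪w + a • L z + b • h, F (w + a • L z + b • h)⟫
      = ⟪w, F w⟫ + 2 * a * ⟪w, E z⟫ + 2 * b * ⟪w, F h⟫ + a ^ 2 * ⟪z, L z⟫
        + 2 * a * b * ⟪z, E h⟫ + b ^ 2 * ⟪h, F h⟫ := by
  simp only [map_add, map_smul, T.F_L, inner_add_left, inner_add_right, inner_smul_left,
    inner_smul_right, T.inner_L_F, T.inner_L_E, T.inner_E_comm h z, T.inner_F_comm h w,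
    RCLike.conj_to_real]
  ring

lemma inner_EF_dual_step (p w z h : H) (a b : ℝ) :
    ⟪p, E (F (w + a • L z + b • h))⟫
      = ⟪p, E (F w)⟫ + a * ⟪p, E z⟫ + b * ⟪p, E (F h)⟫ := by
  simp only [map_add, map_smul, T.F_L, T.E_idem, inner_add_right, inner_smul_right]

lemma inner_L_EF (x y : H) : ⟪L x, E (F y)⟫ = ⟪y, E x⟫ := by
  rw [T.inner_L_E, T.L_F, T.inner_E_comm]

lemma energy_step (α β : ℝ) {γ : ℝ} (hγ : γ ≠ 0) (x z w e h : H) :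
    primalDualEnergy E F ((β + γ) / γ) (x - α • (β • L z + γ • w + e))
        (w + (α * γ) • L z + γ⁻¹ • h)
      = primalDualEnergy E F ((β + γ) / γ) x w
        + α * (-(β * ⟪x, L z⟫) - ⟪x, E e⟫ + γ * ⟪w, E (z - x)⟫ + γ * ⟪x, E z⟫
          - γ * ⟪w, E (F w)⟫ - ⟪e, E (F w)⟫)
        + α ^ 2 * (1 / 2 * ‖E (β • L z + γ • w + e)‖ ^ 2 + γ * (γ - β) / 2 * ⟪z, L z⟫
          - γ ^ 2 * ⟪w, E z⟫ - γ * ⟪e, E z⟫)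
        + ((β + γ) / γ ^ 2 * ⟪w, F h⟫ + (β + γ) / (2 * γ ^ 3) * ⟪h, F h⟫ + γ⁻¹ * ⟪x, E (F h)⟫
          + α * ⟪z, E h⟫ - α * ⟪w, E (F h)⟫ - α * γ⁻¹ * ⟪e, E (F h)⟫) := by
  have hp : ⟪x, E (β • L z + γ • w + e)⟫ = β * ⟪x, L z⟫ + γ * ⟪w, E x⟫ + ⟪x, E e⟫ := by
    simp only [map_add, map_smul, T.E_L, inner_add_right, inner_smul_right, T.inner_E_comm x w]
  rw [primalDualEnergy, T.norm_E_sub_smul_sq, T.inner_F_dual_step, T.inner_EF_dual_step, hp,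
    map_sub E z x]
  simp only [primalDualEnergy, inner_sub_left, inner_add_left, inner_sub_right, inner_smul_left,
    T.inner_L_EF, T.inner_L_E, T.inner_E_comm h z, RCLike.conj_to_real]
  field_simp
  ring

lemma norm_E_sq_le_of_sub (x z : H) : ‖E z‖ ^ 2 ≤ 2 * (‖E x‖ ^ 2 + ‖z - x‖ ^ 2) :=
  calc ‖E z‖ ^ 2 = ‖E x + E (z - x)‖ ^ 2 := by rw [← map_add, add_sub_cancel]
    _ ≤ 2 * (‖E x‖ ^ 2 + ‖E (z - x)‖ ^ 2) := norm_add_sq_le _ _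
    _ ≤ 2 * (‖E x‖ ^ 2 + ‖z - x‖ ^ 2) := by gcongr 2 * (_ + ?_); exact T.norm_E_sq_le _

lemma inner_L_le_of_sub (x z : H) : ⟪z, L z⟫ ≤ 2 * ρ * (‖E x‖ ^ 2 + ‖z - x‖ ^ 2) :=
  calc ⟪z, L z⟫ ≤ ρ * ‖E z‖ ^ 2 := T.inner_L_le z
    _ ≤ ρ * (2 * (‖E x‖ ^ 2 + ‖z - x‖ ^ 2)) :=
      mul_le_mul_of_nonneg_left (T.norm_E_sq_le_of_sub x z) T.rho_pos.le
    _ = _ := by ring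

lemma neg_inner_L_le (x z : H) :
    -⟪x, L z⟫ ≤ -(ρ₂ / 2 * ‖E x‖ ^ 2) + ρ / 2 * ‖z - x‖ ^ 2 := by
  have hzx : ⟪z - x, L (z - x)⟫ ≤ ρ * ‖z - x‖ ^ 2 :=
    (T.inner_L_le _).trans (mul_le_mul_of_nonneg_left (T.norm_E_sq_le _) T.rho_pos.le)
  simp only [map_sub, inner_sub_left, inner_sub_right, ← T.L_symm z x, real_inner_comm x] at hzx
  linarith [T.coercive x, T.inner_L_nonneg z]

lemma inner_E_le_inner_EF_add (w u : H) :
    ⟪w, E u⟫ ≤ 1 / 4 * ⟪w, E (F w)⟫ + ρ * ‖u‖ ^ 2 := by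
  have hρ := T.rho_pos
  have h := (le_abs_self _).trans (abs_two_mul_inner_le (η := (2 * ρ)⁻¹) (by positivity) (E w) u)
  rw [T.E_symm, inv_inv] at h
  have hw : (2 * ρ)⁻¹ * ‖E w‖ ^ 2 ≤ 1 / 2 * ⟪w, E (F w)⟫ :=
    calc _ ≤ (2 * ρ)⁻¹ * (ρ * ⟪w, E (F w)⟫) := by gcongr; exact T.norm_E_sq_le_inner w
      _ = _ := by field_simp
  linarith

lemma first_order_le {β γ ell : ℝ} (hβ : 0 ≤ β) (hγ : 0 ≤ γ) {x e : H} (z w : H)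
    (he : ‖e‖ ^ 2 ≤ ell ^ 2 * ‖E x‖ ^ 2) :
    -(β * ⟪x, L z⟫) - ⟪x, E e⟫ + γ * ⟪w, E (z - x)⟫ + γ * ⟪x, E z⟫ - ⟪e, E (F w)⟫
      ≤ (-(β * ρ₂ / 2) + 1 / 2 + 3 / 2 * γ + 11 / 16 * ell ^ 2) * ‖E x‖ ^ 2
        + (β * ρ / 2 + γ * ρ + γ / 2) * ‖z - x‖ ^ 2
        + (γ / 4 + 5 / 2 * ρ₂⁻¹) * ⟪w, E (F w)⟫ := by
  have hL := mul_le_mul_of_nonneg_left (T.neg_inner_L_le x z) hβ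
  have hw := mul_le_mul_of_nonneg_left (T.inner_E_le_inner_EF_add w (z - x)) hγ
  have hEe := (neg_le_abs _).trans (abs_two_mul_inner_le one_pos (E x) e)
  rw [T.E_symm] at hEe
  have hEz : γ * ⟪x, E z⟫ ≤ γ * (3 / 2 * ‖E x‖ ^ 2 + 1 / 2 * ‖z - x‖ ^ 2) := by
    have h := (le_abs_self _).trans (abs_two_mul_inner_le one_pos (E x) (z - x))
    rw [T.E_symm, map_sub, inner_sub_right, T.inner_E, inv_one] at h
    gcongr
    linarith
  have heF := (neg_le_abs _).trans
    (abs_two_mul_inner_le (by norm_num : (0 : ℝ) < 3 / 8) e (E (F w)))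
  have hρ₂ : 0 ≤ ρ₂⁻¹ * ⟪w, E (F w)⟫ :=
    mul_nonneg (inv_nonneg.2 T.rho2_pos.le) (T.inner_EF_nonneg w)
  norm_num at hEe heF
  linarith [T.norm_EF_sq_le_inner w]

lemma norm_E_direction_sq_le (β γ : ℝ) (z w e : H) :
    ‖E (β • L z + γ • w + e)‖ ^ 2
      ≤ 3 * (β ^ 2 * (ρ * ⟪z, L z⟫) + γ ^ 2 * (ρ * ⟪w, E (F w)⟫) + ‖e‖ ^ 2) := by
  have h := norm_add_three_sq_le (β • L z) (γ • E w) (E e)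
  simp only [norm_smul, mul_pow, Real.norm_eq_abs, sq_abs] at h
  simp only [map_add, map_smul, T.E_L]
  refine h.trans ?_
  gcongr
  exacts [T.bounded z, T.norm_E_sq_le_inner w, sq_le_sq₀ (norm_nonneg _) (norm_nonneg _) |>.1
    (T.norm_E_sq_le e)]

lemma second_order_le {β γ ell : ℝ} (hγ : 0 < γ) (hβγ : 4 * γ ≤ ρ₂ * β) {x e : H} (z w : H)
    (he : ‖e‖ ^ 2 ≤ ell ^ 2 * ‖E x‖ ^ 2) :
    1 / 2 * ‖E (β • L z + γ • w + e)‖ ^ 2 + γ * (γ - β) / 2 * ⟪z, L z⟫ - γ ^ 2 * ⟪w, E z⟫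
        - γ * ⟪e, E z⟫
      ≤ (3 * ρ ^ 2 * β ^ 2 + ρ * γ * (γ - β) + 2 * γ ^ 2 + 2 * ell ^ 2) * ‖E x‖ ^ 2
        + (3 * ρ ^ 2 * β ^ 2 + ρ * γ * (γ - β) + 2 * γ ^ 2) * ‖z - x‖ ^ 2
        + 2 * ρ * γ ^ 2 * ⟪w, E (F w)⟫ := by
  have hdir := T.norm_E_direction_sq_le β γ z w e
  have hβ : 0 < β := (mul_pos_iff_of_pos_left T.rho2_pos).1 (by linarith)
  have hEz := T.norm_E_sq_le_of_sub x z
  have hcoef : 0 ≤ 3 / 2 * (β ^ 2 * ρ) + γ * (γ - β) / 2 := by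
    have h : 4 * γ ≤ ρ * β := hβγ.trans (by gcongr; exact T.rho2_le_rho)
    linarith [mul_le_mul_of_nonneg_left h hβ.le, sq_nonneg γ, mul_pos hβ hγ]
  have hL := mul_le_mul_of_nonneg_left (T.inner_L_le_of_sub x z) hcoef
  have hw : γ ^ 2 * -⟪w, E z⟫
      ≤ γ ^ 2 * (1 / 2 * ρ * ⟪w, E (F w)⟫ + ‖E x‖ ^ 2 + ‖z - x‖ ^ 2) := by
    have h := (neg_le_abs _).trans (abs_two_mul_inner_le one_pos (E w) (E z))
    rw [T.E_symm, T.E_idem, inv_one] at h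
    gcongr
    linarith [T.norm_E_sq_le_inner w]
  have hez : -(2 * (γ * ⟪e, E z⟫))
      ≤ ell ^ 2 * ‖E x‖ ^ 2 + 2 * γ ^ 2 * (‖E x‖ ^ 2 + ‖z - x‖ ^ 2) := by
    have h := (neg_le_abs _).trans (abs_two_mul_inner_le one_pos e (γ • E z))
    rw [inner_smul_right, norm_smul, mul_pow, Real.norm_eq_abs, sq_abs, inv_one] at h
    linarith [mul_le_mul_of_nonneg_left hEz (sq_nonneg γ)]
  linarith

lemma inner_F_drift_le {α β γ K : ℝ} (hα : 0 < α) (hβ : 0 ≤ β) (hγρ : 5 / ρ₂ ≤ γ) {w h g₀ : H}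
    (hw : w - E w = γ⁻¹ • g₀) (hh : ‖h‖ ^ 2 ≤ α ^ 2 * K) :
    (β + γ) / γ ^ 2 * ⟪w, F h⟫ ≤ α * (γ / 4 * ⟪w, E (F w)⟫ + 1 / 20 * ‖g₀‖ ^ 2
      + (β + γ) ^ 2 / γ ^ 5 * ρ₂⁻¹ * K) := by
  have hρ₂ := T.rho2_pos
  have hγ : 0 < γ := lt_of_lt_of_le (by positivity) hγρ
  have hFw : ⟪w, F w⟫ ≤ ⟪w, E (F w)⟫ + γ⁻¹ * (1 / 5) * ‖g₀‖ ^ 2 := by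
    have hlam : lam⁻¹ ≤ γ * (1 / 5) :=
      calc lam⁻¹ ≤ ρ₂⁻¹ := by gcongr; exact T.rho2_le
        _ ≤ γ * (1 / 5) := by rw [div_eq_mul_inv] at hγρ; linarith
    calc ⟪w, F w⟫ = ⟪w, E (F w)⟫ + lam⁻¹ * (γ⁻¹ ^ 2 * ‖g₀‖ ^ 2) := by
          rw [T.inner_F w, hw, norm_smul, mul_pow, Real.norm_eq_abs, sq_abs]
      _ ≤ ⟪w, E (F w)⟫ + γ * (1 / 5) * (γ⁻¹ ^ 2 * ‖g₀‖ ^ 2) := by gcongr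
      _ = _ := by field_simp
  have hFh : ⟪h, F h⟫ ≤ ρ₂⁻¹ * (α ^ 2 * K) := (T.inner_F_le h).trans (by gcongr)
  set η := α * γ ^ 3 / (2 * (β + γ)) with hη
  have hη_pos : 0 < η := by positivity
  calc (β + γ) / γ ^ 2 * ⟪w, F h⟫ = (β + γ) / (2 * γ ^ 2) * (2 * ⟪w, F h⟫) := by ring
    _ ≤ (β + γ) / (2 * γ ^ 2) * (η * ⟪w, F w⟫ + η⁻¹ * ⟪h, F h⟫) := by
      gcongr
      exact T.two_mul_inner_F_le hη_pos w h
    _ ≤ (β + γ) / (2 * γ ^ 2) * (η * (⟪w, E (F w)⟫ + γ⁻¹ * (1 / 5) * ‖g₀‖ ^ 2)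
          + η⁻¹ * (ρ₂⁻¹ * (α ^ 2 * K))) := by gcongr
    _ = _ := by rw [hη]; field_simp; ring

lemma drift_le {α β γ ell K : ℝ} (hα : 0 < α) (hβ : 0 ≤ β) (hγρ : 5 / ρ₂ ≤ γ)
    {x w e h g₀ : H} (z : H) (hw : w - E w = γ⁻¹ • g₀) (he : ‖e‖ ^ 2 ≤ ell ^ 2 * ‖E x‖ ^ 2)
    (hh : ‖h‖ ^ 2 ≤ α ^ 2 * K) :
    (β + γ) / γ ^ 2 * ⟪w, F h⟫ + (β + γ) / (2 * γ ^ 3) * ⟪h, F h⟫ + γ⁻¹ * ⟪x, E (F h)⟫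
        + α * ⟪z, E h⟫ - α * ⟪w, E (F h)⟫ - α * γ⁻¹ * ⟪e, E (F h)⟫
      ≤ α * (γ / 4 * ⟪w, E (F w)⟫ + 1 / 20 * ‖g₀‖ ^ 2 + 1 / 2 * ‖E x‖ ^ 2
          + ((β + γ) ^ 2 / γ ^ 5 * ρ₂⁻¹ + 1 / (2 * γ ^ 2) * ρ₂⁻¹ ^ 2) * K)
        + α ^ 2 * ((1 + ell ^ 2 / 2) * ‖E x‖ ^ 2 + ‖z - x‖ ^ 2 + ρ / 2 * ⟪w, E (F w)⟫
          + ((β + γ) / (2 * γ ^ 3) * ρ₂⁻¹ + 1 / (2 * γ ^ 2) * ρ₂⁻¹ ^ 2 + ρ₂⁻¹ ^ 2 / 2 + 1 / 2)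
            * K) := by
  have hρ₂ := T.rho2_pos
  have hγ : 0 < γ := lt_of_lt_of_le (by positivity) hγρ
  have hEFh : ‖E (F h)‖ ^ 2 ≤ α ^ 2 * (ρ₂⁻¹ ^ 2 * K) :=
    (T.norm_EF_sq_le h).trans (by rw [mul_left_comm]; gcongr)
  have hwF := T.inner_F_drift_le hα hβ hγρ hw hh
  have hhF : (β + γ) / (2 * γ ^ 3) * ⟪h, F h⟫ ≤ (β + γ) / (2 * γ ^ 3) * (ρ₂⁻¹ * (α ^ 2 * K)) := by
    gcongr
    exact (T.inner_F_le h).trans (by gcongr)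
  have hx : γ⁻¹ * ⟪x, E (F h)⟫ ≤ γ⁻¹ * (1 / 2 * (α * (γ * ‖E x‖ ^ 2 + γ⁻¹ * (ρ₂⁻¹ ^ 2 * K)))) := by
    have := (le_abs_self _).trans (abs_two_mul_inner_le_of_norm_sq_le hγ hα (E x) hEFh)
    rw [T.E_symm, T.E_idem] at this
    gcongr
    linarith
  have hz : α * ⟪z, E h⟫ ≤ α * (1 / 2 * (α * (2 * (‖E x‖ ^ 2 + ‖z - x‖ ^ 2) + K))) := by
    have := (le_abs_self _).trans (abs_two_mul_inner_le_of_norm_sq_le one_pos hα (E z) hh)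
    rw [T.E_symm, inv_one, one_mul, one_mul] at this
    gcongr
    linarith [mul_le_mul_of_nonneg_left (T.norm_E_sq_le_of_sub x z) hα.le]
  have hwEF : α * -⟪w, E (F h)⟫ ≤ α * (1 / 2 * (α * (ρ * ⟪w, E (F w)⟫ + ρ₂⁻¹ ^ 2 * K))) := by
    have := (neg_le_abs _).trans (abs_two_mul_inner_le_of_norm_sq_le one_pos hα (E w) hEFh)
    rw [T.E_symm, T.E_idem, inv_one, one_mul, one_mul] at this
    gcongr
    linarith [mul_le_mul_of_nonneg_left (T.norm_E_sq_le_inner w) hα.le]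
  have heEF : α * γ⁻¹ * -⟪e, E (F h)⟫
      ≤ α * γ⁻¹ * (1 / 2 * (α * (γ * (ell ^ 2 * ‖E x‖ ^ 2) + γ⁻¹ * (ρ₂⁻¹ ^ 2 * K)))) := by
    have := (neg_le_abs _).trans (abs_two_mul_inner_le_of_norm_sq_le hγ hα e hEFh)
    gcongr
    linarith [mul_le_mul_of_nonneg_left he (mul_pos hα hγ).le]
  refine (by linarith : _ ≤ _).trans
    ((add_le_add (add_le_add (add_le_add (add_le_add (add_le_add hwF hhF) hx) hz) hwEF)
      heEF).trans_eq ?_)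
  field_simp
  ring

end IsLaplacianTriple

theorem IsLaplacianTriple.energy_descent {P : Params} {L E F : H →ₗ[ℝ] H} {lam : ℝ}
    (T : IsLaplacianTriple L E F P.rho2 P.rho lam) {α : ℝ} (hα : 0 < α)
    (hβγ : 4 * P.γ ≤ P.rho2 * P.β) (hγρ : 5 / P.rho2 ≤ P.γ) {x z w e h g g₀ : H}
    (hw : w - E w = P.γ⁻¹ • g₀) (he : ‖e‖ ^ 2 ≤ P.ell ^ 2 * ‖E x‖ ^ 2)
    (hg : ‖g - g₀‖ ^ 2 ≤ P.ell ^ 2 * ‖E x‖ ^ 2)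
    (hh : ‖h‖ ^ 2 ≤ α ^ 2 * (P.ell ^ 2 * ‖g‖ ^ 2)) :
    primalDualEnergy E F ((P.β + P.γ) / P.γ) (x - α • (P.β • L z + P.γ • w + e))
        (w + (α * P.γ) • L z + P.γ⁻¹ • h)
        + (-(α * ⟪g, g₀⟫) + P.ell / 2 * α ^ 2 * ‖g‖ ^ 2)
      ≤ primalDualEnergy E F ((P.β + P.γ) / P.γ) x w
        - α * (P.φ₁ - α * P.φ₂) * ‖E x‖ ^ 2 - α * (P.φ₃ - α * P.φ₄) * ⟪w, E (F w)⟫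
        - α * (P.φ₅ - α * P.φ₆) * ‖g‖ ^ 2 - 3 / 40 * α * ‖g₀‖ ^ 2
        + α * P.ψ₂ α * ‖z - x‖ ^ 2 := by
  have hρ₂ := T.rho2_pos
  have hγ : 0 < P.γ := lt_of_lt_of_le (by positivity) hγρ
  have hβ : 0 < P.β := (mul_pos_iff_of_pos_left hρ₂).1 (by linarith)
  have hfirst := mul_le_mul_of_nonneg_left (T.first_order_le hβ.le hγ.le z w he) hα.le
  have hsecond := mul_le_mul_of_nonneg_left (T.second_order_le hγ hβγ z w he) (sq_nonneg α)
  have hdrift := T.drift_le hα hβ.le hγρ z hw he hh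
  have hcost := mul_le_mul_of_nonneg_left (neg_inner_gradient_le hg) hα.le
  have hslack : 0 ≤ α ^ 2 * (P.β * P.γ * (P.rho - P.rho2)) * (‖E x‖ ^ 2 + 2 * ‖z - x‖ ^ 2) := by
    have := sub_nonneg.2 T.rho2_le_rho
    positivity
  have hslack' : 0 ≤ α * P.γ * ‖z - x‖ ^ 2 := by positivity
  rw [T.energy_step α P.β hγ.ne']
  simp only [Params.φ₁, Params.φ₂, Params.φ₃, Params.φ₄, Params.φ₅, Params.φ₆, Params.ψ₂,
    Params.φ₇, Params.φ₈]
  linarith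

end EnergyDescent

/-! ### Spectral bounds for the graph Laplacian -/

section Spectral

open Matrix
open scoped RealInnerProductSpace

lemma posSemidef_of_mulVec_orthonormalBasis {ι : Type*} [Fintype ι]
    (b : OrthonormalBasis ι ℝ (EuclideanSpace ℝ ι)) {M : Matrix ι ι ℝ} {c : ι → ℝ}
    (hc : ∀ i, 0 ≤ c i) (hM : ∀ i, M *ᵥ (b i).ofLp = c i • (b i).ofLp) : M.PosSemidef := by
  classical
  have hsum (x : EuclideanSpace ℝ ι) : toEuclideanLin M x = ∑ i, (c i * ⟪b i, x⟫) • b i := by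
    conv_lhs => rw [← b.sum_repr' x, map_sum]
    refine Finset.sum_congr rfl fun i _ => ?_
    rw [map_smul, toLpLin_apply, hM, WithLp.toLp_smul, WithLp.toLp_ofLp, smul_smul, mul_comm]
  refine isPositive_toEuclideanLin_iff.1 ⟨fun x y => ?_, fun x => ?_⟩
  · rw [hsum, hsum, sum_inner, inner_sum]
    refine Finset.sum_congr rfl fun i _ => ?_
    rw [inner_smul_right, real_inner_smul_left, real_inner_comm x]
    ring
  · rw [hsum, sum_inner, RCLike.re_to_real]
    refine Finset.sum_nonneg fun i _ => ?_
    rw [real_inner_smul_left, mul_assoc]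
    exact mul_nonneg (hc i) (mul_self_nonneg _)

variable {n : ℕ}

lemma avgMat_mulVec_apply (v : Fin n → ℝ) (i : Fin n) : (avgMat n *ᵥ v) i = 1 / n * ∑ j, v j := by
  simp [avgMat, mulVec, dotProduct, Finset.mul_sum]

lemma matE_mulVec_of_const {v : Fin n → ℝ} (hv : ∀ i j, v i = v j) : matE n *ᵥ v = 0 := by
  ext i
  have hn : (n : ℝ) ≠ 0 := Nat.cast_ne_zero.2 i.pos.ne'
  rw [matE, sub_mulVec, one_mulVec, Pi.sub_apply, avgMat_mulVec_apply,
    Finset.sum_congr rfl fun j _ => hv j i]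
  simp [hn]

lemma avgMat_transpose : (avgMat n)ᵀ = avgMat n := rfl

lemma matE_transpose : (matE n)ᵀ = matE n := by
  rw [matE, transpose_sub, transpose_one, avgMat_transpose]

lemma avgMat_mul_self : avgMat n * avgMat n = avgMat n := by
  ext i j
  have hn : (n : ℝ) ≠ 0 := Nat.cast_ne_zero.2 i.pos.ne'
  simp [avgMat, mul_apply, hn]

lemma matE_mul_self : matE n * matE n = matE n := by
  rw [matE, mul_sub, mul_one, sub_mul, one_mul, avgMat_mul_self, sub_self, sub_zero]

lemma le_rhoMax_of_mem_spectrum {M : Matrix (Fin n) (Fin n) ℝ} {μ : ℝ} (hμ : μ ∈ spectrum ℝ M) :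
    μ ≤ rhoMax M := by
  have hfin : spectralRadius ℝ M ≠ ⊤ := by
    obtain ⟨R, hR⟩ := (M.finite_real_spectrum.image fun k => ‖k‖₊).bddAbove
    exact ne_top_of_le_ne_top (ENNReal.coe_ne_top (r := R))
      (iSup₂_le fun k hk => ENNReal.coe_le_coe.2 (hR ⟨k, hk, rfl⟩))
  have h := ENNReal.toReal_mono hfin (le_iSup₂ (f := fun k _ => (‖k‖₊ : ℝ≥0∞)) μ hμ)
  rw [ENNReal.coe_toReal, coe_nnnorm] at h
  exact (le_abs_self μ).trans h

variable {A : Matrix (Fin n) (Fin n) ℝ}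

lemma laplacian_mul_avgMat : laplacian A * avgMat n = 0 := by
  ext i j
  simp [avgMat, mul_apply, laplacian, diagonal_apply, Finset.sum_sub_distrib, ← Finset.sum_mul]

lemma laplacian_mul_matE : laplacian A * matE n = laplacian A := by
  rw [matE, mul_sub, mul_one, laplacian_mul_avgMat, sub_zero]

namespace IsUndirectedConnected

variable (hA : IsUndirectedConnected A)
include hA

lemma laplacian_transpose : (laplacian A)ᵀ = laplacian A := by
  rw [laplacian, transpose_sub, diagonal_transpose, show Aᵀ = A from ext fun i j => hA.symm j i]

lemma avgMat_mul_laplacian : avgMat n * laplacian A = 0 := by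
  have h := congrArg transpose (laplacian_mul_avgMat (A := A))
  rwa [transpose_mul, avgMat_transpose, hA.laplacian_transpose, transpose_zero] at h

lemma matE_mul_laplacian : matE n * laplacian A = laplacian A := by
  rw [matE, sub_mul, one_mul, hA.avgMat_mul_laplacian, sub_zero]

lemma dotProduct_laplacian_mulVec (v : Fin n → ℝ) :
    v ⬝ᵥ laplacian A *ᵥ v = 1 / 2 * ∑ i, ∑ j, A i j * (v i - v j) ^ 2 := by
  have hform : v ⬝ᵥ laplacian A *ᵥ v = ∑ i, ∑ j, (A i j * v i ^ 2 - A i j * (v i * v j)) := by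
    refine Finset.sum_congr rfl fun i _ => ?_
    rw [laplacian, sub_mulVec, Pi.sub_apply, mulVec_diagonal, Finset.sum_sub_distrib, mul_sub]
    simp only [mulVec, dotProduct, Finset.mul_sum, Finset.sum_mul]
    congr 1 <;> exact Finset.sum_congr rfl fun j _ => by ring
  have hswap : ∑ i, ∑ j, A i j * v j ^ 2 = ∑ i, ∑ j, A i j * v i ^ 2 := by
    rw [Finset.sum_comm]
    simp only [hA.symm]
  have hsq : ∑ i, ∑ j, A i j * (v i - v j) ^ 2
      = ∑ i, ∑ j, A i j * v i ^ 2 + ∑ i, ∑ j, A i j * v j ^ 2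
        - 2 * ∑ i, ∑ j, A i j * (v i * v j) := by
    simp only [Finset.mul_sum, ← Finset.sum_add_distrib, ← Finset.sum_sub_distrib]
    exact Finset.sum_congr rfl fun i _ => Finset.sum_congr rfl fun j _ => by ring
  rw [hform, hsq, hswap]
  simp only [Finset.sum_sub_distrib]
  ring

lemma weight_mul_sub_sq_nonneg (v : Fin n → ℝ) (i j : Fin n) : 0 ≤ A i j * (v i - v j) ^ 2 :=
  mul_nonneg (hA.nonneg i j) (sq_nonneg _)

lemma laplacian_posSemidef : (laplacian A).PosSemidef := by
  refine .of_dotProduct_mulVec_nonneg ?_ fun v => ?_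
  · rw [IsHermitian, conjTranspose_eq_transpose_of_trivial, hA.laplacian_transpose]
  · rw [star_trivial, hA.dotProduct_laplacian_mulVec]
    exact mul_nonneg one_half_pos.le (Finset.sum_nonneg fun i _ => Finset.sum_nonneg fun j _ =>
      hA.weight_mul_sub_sq_nonneg v i j)

lemma eq_of_laplacian_mulVec_eq_zero {v : Fin n → ℝ} (hv : laplacian A *ᵥ v = 0) (i j : Fin n) :
    v i = v j := by
  have hsum : ∑ i, ∑ j, A i j * (v i - v j) ^ 2 = 0 := by
    simpa [hv] using hA.dotProduct_laplacian_mulVec v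
  have hadj {a b : Fin n} (hab : 0 < A a b) : v a = v b := by
    have hrow := (Finset.sum_eq_zero_iff_of_nonneg fun i _ =>
      Finset.sum_nonneg fun j _ => hA.weight_mul_sub_sq_nonneg v i j).1 hsum a (Finset.mem_univ a)
    have hentry := (Finset.sum_eq_zero_iff_of_nonneg fun j _ =>
      hA.weight_mul_sub_sq_nonneg v a j).1 hrow b (Finset.mem_univ b)
    exact sub_eq_zero.1 (sq_eq_zero_iff.1 ((mul_eq_zero_iff_left hab.ne').1 hentry))
  obtain ⟨p⟩ := hA.connected.preconnected i j
  induction p with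
  | nil => rfl
  | cons hab _ ih =>
    rw [← ih]
    rcases ((SimpleGraph.fromRel_adj _ _ _).1 hab).2 with hab | hba
    exacts [hadj hab, (hadj hba).symm]

lemma rhoTwo_pos (hn : 2 ≤ n) : 0 < rhoTwo (laplacian A) := by
  have hL := hA.laplacian_posSemidef
  have hne : {μ : ℝ | μ ∈ spectrum ℝ (laplacian A) ∧ 0 < μ}.Nonempty := by
    obtain ⟨i, hi⟩ : ∃ i, hL.1.eigenvalues i ≠ 0 := by
      by_contra! h
      have hzero : laplacian A = 0 := hL.1.eigenvalues_eq_zero_iff.1 (funext h)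
      have := hA.eq_of_laplacian_mulVec_eq_zero (v := Pi.single (⟨0, by omega⟩ : Fin n) 1)
        (by rw [hzero, zero_mulVec]) ⟨0, by omega⟩ ⟨1, by omega⟩
      simp at this
    exact ⟨_, hL.1.eigenvalues_mem_spectrum_real i, (hL.eigenvalues_nonneg i).lt_of_ne' hi⟩
  exact (hne.csInf_mem ((laplacian A).finite_real_spectrum.subset fun _ h => h.1)).2

lemma posSemidef_rhoMax_smul_sub_sq :
    (rhoMax (laplacian A) • laplacian A - laplacian A * laplacian A).PosSemidef := by
  have hL := hA.laplacian_posSemidef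
  refine posSemidef_of_mulVec_orthonormalBasis hL.1.eigenvectorBasis
    (c := fun i => (rhoMax (laplacian A) - hL.1.eigenvalues i) * hL.1.eigenvalues i)
    (fun i => mul_nonneg ?_ (hL.eigenvalues_nonneg i)) fun i => ?_
  · exact sub_nonneg.2 (le_rhoMax_of_mem_spectrum (hL.1.eigenvalues_mem_spectrum_real i))
  · simp only [sub_mulVec, smul_mulVec, ← mulVec_mulVec, hL.1.mulVec_eigenvectorBasis,
      mulVec_smul, smul_smul, sub_mul, sub_smul]

lemma posSemidef_laplacian_sub_rhoTwo_smul :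
    (laplacian A - rhoTwo (laplacian A) • matE n).PosSemidef := by
  have hL := hA.laplacian_posSemidef
  set b := hL.1.eigenvectorBasis
  set μ := hL.1.eigenvalues
  have hb (i : Fin n) : laplacian A *ᵥ (b i).ofLp = μ i • (b i).ofLp :=
    hL.1.mulVec_eigenvectorBasis i
  refine posSemidef_of_mulVec_orthonormalBasis b
    (c := fun i => if μ i = 0 then 0 else μ i - rhoTwo (laplacian A)) (fun i => ?_) fun i => ?_
  · split_ifs with hi
    · rfl
    · exact sub_nonneg.2 (csInf_le ⟨0, fun _ h => h.2.le⟩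
        ⟨hL.1.eigenvalues_mem_spectrum_real i, (hL.eigenvalues_nonneg i).lt_of_ne' hi⟩)
  · rw [sub_mulVec, smul_mulVec, hb]
    split_ifs with hi
    · have hker : laplacian A *ᵥ (b i).ofLp = 0 := by rw [hb, hi, zero_smul]
      rw [matE_mulVec_of_const (hA.eq_of_laplacian_mulVec_eq_zero hker), hi, smul_zero, sub_zero]
    · have hE : matE n *ᵥ (b i).ofLp = (b i).ofLp := by
        rw [← inv_smul_smul₀ hi (b i).ofLp, ← hb, mulVec_smul, mulVec_mulVec,
          hA.matE_mul_laplacian]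
      rw [hE, sub_smul]

lemma isUnit_det_laplacian_add {lam : ℝ} (hlam : lam ≠ 0) :
    IsUnit (laplacian A + lam • avgMat n).det := by
  rw [← isUnit_iff_isUnit_det, ← mulVec_injective_iff_isUnit]
  refine (injective_iff_map_eq_zero (mulVecLin (laplacian A + lam • avgMat n))).2 fun v hv => ?_
  rw [mulVecLin_apply, add_mulVec, smul_mulVec] at hv
  have hJ : avgMat n *ᵥ v = 0 := by
    have h := congrArg (avgMat n *ᵥ ·) hv
    simpa [mulVec_add, mulVec_smul, hA.avgMat_mul_laplacian, avgMat_mul_self, hlam] using h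
  have hL : laplacian A *ᵥ v = 0 := by simpa [hJ] using hv
  have hE := matE_mulVec_of_const (hA.eq_of_laplacian_mulVec_eq_zero hL)
  rwa [matE, sub_mulVec, one_mulVec, hJ, sub_zero] at hE

end IsUndirectedConnected

end Spectral

/-! ### Matrices acting on stacked vectors -/

section Stacked

open Matrix
open scoped RealInnerProductSpace MatrixOrder

variable {n d : ℕ}

/-- The Hilbert space `(ℝ^d)^n` of all agents' vectors, with the Euclidean norm. -/
abbrev Stacked (n d : ℕ) := PiLp 2 (fun _ : Fin n => Vec d)

/-- The element of `Stacked n d` with blocks `x i`. -/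
abbrev stack (x : Fin n → Vec d) : Stacked n d := WithLp.toLp 2 x

/-- The action `M ↦ M ⊗ I_d` of `n × n` matrices on stacked vectors. -/
noncomputable def matAct : Matrix (Fin n) (Fin n) ℝ →ₐ[ℝ] Module.End ℝ (Stacked n d) :=
  .ofLinearMap
    { toFun M :=
        { toFun x := stack fun i => ∑ j, M i j • x j
          map_add' x y := by
            ext i : 1
            simp [smul_add, Finset.sum_add_distrib]
          map_smul' c x := by
            ext i : 1
            simp [Finset.smul_sum, smul_comm c] }
      map_add' M N := by
        ext x i : 2
        simp [add_smul, Finset.sum_add_distrib]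
      map_smul' c M := by
        ext x i : 2
        simp [Finset.smul_sum, mul_smul] }
    (by ext x i : 2; simp [one_apply])
    fun M N => by
      ext x i : 2
      simp only [LinearMap.coe_mk, AddHom.coe_mk, Module.End.mul_apply, mul_apply, Finset.sum_smul,
        Finset.smul_sum, mul_smul]
      exact Finset.sum_comm

lemma matAct_apply (M : Matrix (Fin n) (Fin n) ℝ) (x : Stacked n d) (i : Fin n) :
    matAct M x i = ∑ j, M i j • x j := rfl

lemma inner_matAct_stack (M : Matrix (Fin n) (Fin n) ℝ) (x y : Fin n → Vec d) :
    ⟪stack x, matAct M (stack y)⟫ = wInner M x y := by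
  simp [PiLp.inner_apply, matAct_apply, wInner, inner_sum, inner_smul_right]

lemma inner_matAct_left (M : Matrix (Fin n) (Fin n) ℝ) (x y : Stacked n d) :
    ⟪matAct M x, y⟫ = ⟪x, matAct Mᵀ y⟫ := by
  simp only [PiLp.inner_apply, matAct_apply, inner_sum, sum_inner, inner_smul_right,
    inner_smul_left, RCLike.conj_to_real, transpose_apply]
  rw [Finset.sum_comm]

lemma inner_matAct_nonneg {M : Matrix (Fin n) (Fin n) ℝ} (hM : M.PosSemidef) (x : Stacked n d) :
    0 ≤ ⟪x, matAct M x⟫ := by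
  obtain ⟨B, rfl⟩ := CStarAlgebra.nonneg_iff_eq_star_mul_self.1 (nonneg_iff_posSemidef.2 hM)
  rw [star_eq_conjTranspose, conjTranspose_eq_transpose_of_trivial, map_mul, Module.End.mul_apply,
    ← inner_matAct_left]
  exact real_inner_self_nonneg

lemma matAct_avgMat_stack (x : Fin n → Vec d) :
    matAct (avgMat n) (stack x) = stack fun _ => mean x := by
  ext i : 1
  simp [matAct_apply, avgMat, mean, Finset.smul_sum]

lemma sub_matAct_matE (x : Stacked n d) : x - matAct (matE n) x = matAct (avgMat n) x := by
  rw [matE, map_sub, map_one, LinearMap.sub_apply, Module.End.one_apply, sub_sub_cancel]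

variable {A : Matrix (Fin n) (Fin n) ℝ}

theorem isLaplacianTriple_matAct (d : ℕ) (hA : IsUndirectedConnected A) (hn : 2 ≤ n) {lam : ℝ}
    (hlam : lam ∈ Set.Icc (rhoTwo (laplacian A)) (rhoMax (laplacian A))) :
    IsLaplacianTriple (matAct (d := d) (laplacian A)) (matAct (matE n))
      (matAct (matF (laplacian A) lam)) (rhoTwo (laplacian A)) (rhoMax (laplacian A)) lam where
  L_symm x y := by rw [inner_matAct_left, hA.laplacian_transpose]
  E_symm x y := by rw [inner_matAct_left, matE_transpose]
  E_idem x := by rw [← Module.End.mul_apply, ← map_mul, matE_mul_self]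
  L_E x := by rw [← Module.End.mul_apply, ← map_mul, laplacian_mul_matE]
  F_leftInv x := by
    have hinv : matF (laplacian A) lam * (laplacian A + lam • avgMat n) = 1 :=
      nonsing_inv_mul _ (hA.isUnit_det_laplacian_add ((hA.rhoTwo_pos hn).trans_le hlam.1).ne')
    rw [sub_matAct_matE, ← LinearMap.smul_apply, ← map_smul, ← LinearMap.add_apply, ← map_add,
      ← Module.End.mul_apply, ← map_mul, hinv, map_one, Module.End.one_apply]
  F_rightInv x := by
    have hinv : (laplacian A + lam • avgMat n) * matF (laplacian A) lam = 1 :=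
      mul_nonsing_inv _ (hA.isUnit_det_laplacian_add ((hA.rhoTwo_pos hn).trans_le hlam.1).ne')
    rw [sub_matAct_matE, ← LinearMap.smul_apply, ← map_smul, ← LinearMap.add_apply, ← map_add,
      ← Module.End.mul_apply, ← map_mul, hinv, map_one, Module.End.one_apply]
  rho2_pos := hA.rhoTwo_pos hn
  rho2_le := hlam.1
  le_rho := hlam.2
  coercive x := by
    have h := inner_matAct_nonneg hA.posSemidef_laplacian_sub_rhoTwo_smul x
    have hE : ‖matAct (matE n) x‖ ^ 2 = ⟪x, matAct (matE n) x⟫ := by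
      rw [← real_inner_self_eq_norm_sq, inner_matAct_left, matE_transpose, ← Module.End.mul_apply,
        ← map_mul, matE_mul_self]
    rw [map_sub, map_smul, LinearMap.sub_apply, LinearMap.smul_apply, inner_sub_right,
      inner_smul_right, ← hE] at h
    exact sub_nonneg.1 h
  bounded x := by
    have h := inner_matAct_nonneg hA.posSemidef_rhoMax_smul_sub_sq x
    rw [map_sub, map_smul, map_mul, LinearMap.sub_apply, LinearMap.smul_apply, Module.End.mul_apply,
      inner_sub_right, inner_smul_right] at h
    rw [← real_inner_self_eq_norm_sq, inner_matAct_left, hA.laplacian_transpose]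
    exact sub_nonneg.1 h

end Stacked

/-! ### Norm comparison and the compression error -/

section LpNorm

variable {d : ℕ} {p q : ℝ≥0∞}

lemma lpNorm_nonneg (hp : 1 ≤ p) (x : Vec d) : 0 ≤ lpNorm p x :=
  have : Fact (1 ≤ p) := ⟨hp⟩
  norm_nonneg _

lemma lpNorm_add_le (hp : 1 ≤ p) (x y : Vec d) : lpNorm p (x + y) ≤ lpNorm p x + lpNorm p y :=
  have : Fact (1 ≤ p) := ⟨hp⟩
  norm_add_le (WithLp.toLp p x.ofLp) (WithLp.toLp p y.ofLp)

lemma lpNorm_smul (hp : 1 ≤ p) (c : ℝ) (x : Vec d) : lpNorm p (c • x) = |c| * lpNorm p x :=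
  have : Fact (1 ≤ p) := ⟨hp⟩
  norm_smul c (WithLp.toLp p x.ofLp)

lemma abs_apply_le_lpNorm (hp : 1 ≤ p) (x : Vec d) (i : Fin d) : |x i| ≤ lpNorm p x :=
  have : Fact (1 ≤ p) := ⟨hp⟩
  PiLp.norm_apply_le (WithLp.toLp p x.ofLp) i

lemma lpNorm_top_le {c : ℝ} (hc : 0 ≤ c) {x : Vec d} (hx : ∀ i, |x i| ≤ c) : lpNorm ⊤ x ≤ c := by
  rw [lpNorm, PiLp.norm_toLp]
  exact (pi_norm_le_iff_of_nonneg hc).2 hx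

lemma lpNorm_rpow (hp : 0 < p.toReal) (x : Vec d) :
    lpNorm p x ^ p.toReal = ∑ i, |x i| ^ p.toReal := by
  rw [lpNorm, PiLp.norm_eq_sum hp, one_div, Real.rpow_inv_rpow (by positivity) hp.ne']
  rfl

lemma lpNorm_anti (hp : 1 ≤ p) (hpq : p ≤ q) (x : Vec d) : lpNorm q x ≤ lpNorm p x := by
  have hx := abs_apply_le_lpNorm hp x
  have hS := lpNorm_nonneg hp x
  rcases eq_or_ne q ⊤ with rfl | hq
  · exact lpNorm_top_le hS hx
  have hp_pos : 0 < p.toReal :=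
    ENNReal.toReal_pos (one_pos.trans_le hp).ne' (ne_top_of_le_ne_top hq hpq)
  have hpq' : p.toReal ≤ q.toReal := ENNReal.toReal_mono hq hpq
  have hsplit {t : ℝ} (ht : 0 ≤ t) : t ^ q.toReal = t ^ p.toReal * t ^ (q.toReal - p.toReal) := by
    rw [← Real.rpow_add_of_nonneg ht hp_pos.le (sub_nonneg.2 hpq'), add_sub_cancel]
  have hq_pos := hp_pos.trans_le hpq'
  rw [← Real.rpow_le_rpow_iff (lpNorm_nonneg (hp.trans hpq) x) hS hq_pos, lpNorm_rpow hq_pos,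
    hsplit hS, lpNorm_rpow hp_pos, Finset.sum_mul]
  refine Finset.sum_le_sum fun i _ => ?_
  rw [hsplit (abs_nonneg _)]
  have := sub_nonneg.2 hpq'
  gcongr
  exact hx i

lemma lpNorm_le_rpow_mul (hp : 1 ≤ p) (hpq : p ≤ q) (x : Vec d) :
    lpNorm p x ≤ (d : ℝ) ^ (p⁻¹.toReal - q⁻¹.toReal) * lpNorm q x := by
  rcases eq_or_ne p ⊤ with rfl | hp'
  · rw [top_le_iff.1 hpq, sub_self, Real.rpow_zero, one_mul]
  have hp_pos : 0 < p.toReal := ENNReal.toReal_pos (one_pos.trans_le hp).ne' hp'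
  have hS := lpNorm_nonneg (hp.trans hpq) x
  rw [← Real.rpow_le_rpow_iff (lpNorm_nonneg hp x) (by positivity) hp_pos, lpNorm_rpow hp_pos,
    Real.mul_rpow (by positivity) hS, ← Real.rpow_mul (Nat.cast_nonneg d), ENNReal.toReal_inv,
    sub_mul, inv_mul_cancel₀ hp_pos.ne']
  rcases eq_or_ne q ⊤ with rfl | hq
  · calc ∑ i, |x i| ^ p.toReal ≤ ∑ _i : Fin d, lpNorm ⊤ x ^ p.toReal := by
          gcongr with i
          exact abs_apply_le_lpNorm le_top x i
      _ = _ := by simp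
  have hpq' : p.toReal ≤ q.toReal := ENNReal.toReal_mono hq hpq
  have hq_pos := hp_pos.trans_le hpq'
  have hmean := Real.rpow_sum_le_const_mul_sum_rpow_of_nonneg Finset.univ
    (f := fun i => |x i| ^ p.toReal) ((one_le_div hp_pos).2 hpq') fun i _ => by positivity
  simp only [← Real.rpow_mul (abs_nonneg _), mul_div_cancel₀ _ hp_pos.ne', ← lpNorm_rpow hq_pos,
    Finset.card_univ, Fintype.card_fin] at hmean
  rw [← Real.rpow_le_rpow_iff (by positivity) (by positivity) (div_pos hq_pos hp_pos)]
  refine hmean.trans_eq ?_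
  rw [Real.mul_rpow (by positivity) (by positivity), ← Real.rpow_mul (Nat.cast_nonneg d),
    ← Real.rpow_mul hS, ENNReal.toReal_inv]
  congr 2 <;> field_simp

lemma lpNorm_two (x : Vec d) : lpNorm 2 x = ‖x‖ := rfl

lemma lpNorm_le_dHat_mul (hp : 1 ≤ p) (x : Vec d) : lpNorm p x ≤ dHat p d * ‖x‖ := by
  unfold dHat
  split_ifs with h
  · simpa [lpNorm_two] using lpNorm_le_rpow_mul hp h x
  · exact (lpNorm_anti (by norm_num) (not_le.1 h).le x).trans_eq (one_mul _).symm

lemma norm_le_dTilde_mul (hp : 1 ≤ p) (x : Vec d) : ‖x‖ ≤ dTilde p d * lpNorm p x := by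
  unfold dTilde
  split_ifs with h
  · exact (lpNorm_anti hp h x).trans_eq (one_mul _).symm
  · simpa [lpNorm_two] using lpNorm_le_rpow_mul (by norm_num) (not_le.1 h).le x

lemma one_le_dTilde (hd : 1 ≤ d) : 1 ≤ dTilde p d := by
  unfold dTilde
  split_ifs with h
  · rfl
  · have hp : p⁻¹.toReal ≤ (2⁻¹ : ℝ≥0∞).toReal :=
      ENNReal.toReal_mono (by simp) (ENNReal.inv_le_inv.2 (not_le.1 h).le)
    exact Real.one_le_rpow (by exact_mod_cast hd) (by simpa using hp)

lemma lpNorm_sub_compress_sq_le (hp : 1 ≤ p) {r C δ ω s : ℝ} (hr : 0 < r)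
    (hω : 0 < ω) (hωr : ω ≤ 1 / r) (hs : 0 < s) {Cmp : Vec d → Vec d}
    (hCmp : IsLocallyBounded p r C δ Cmp) {z : Vec d} (hz : lpNorm p z ≤ C * s) :
    lpNorm p (z - (ω * s) • Cmp (s⁻¹ • z)) ^ 2
      ≤ (1 - 2 * (ω * r * (δ - δ ^ 2 / 2))) * (C * s) ^ 2 := by
  have hscaled : lpNorm p (s⁻¹ • z) ≤ C := by
    rw [lpNorm_smul hp, abs_of_pos (inv_pos.2 hs), inv_mul_le_iff₀ hs, mul_comm s]
    exact hz
  have hωr' : 0 ≤ 1 - ω * r := by rwa [sub_nonneg, ← le_div_iff₀ hr]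
  have hconvex : z - (ω * s) • Cmp (s⁻¹ • z)
      = (1 - ω * r) • z + (-(ω * r * s)) • (r⁻¹ • Cmp (s⁻¹ • z) - s⁻¹ • z) := by
    match_scalars <;> field_simp
    ring
  have herror : lpNorm p (z - (ω * s) • Cmp (s⁻¹ • z)) ≤ C * s * (1 - ω * r * δ) :=
    calc _ ≤ (1 - ω * r) * lpNorm p z
          + ω * r * s * lpNorm p (r⁻¹ • Cmp (s⁻¹ • z) - s⁻¹ • z) := by
          rw [hconvex]
          refine (lpNorm_add_le hp _ _).trans_eq ?_
          rw [lpNorm_smul hp, lpNorm_smul hp, abs_neg, abs_of_nonneg hωr', abs_of_pos]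
          positivity
      _ ≤ (1 - ω * r) * (C * s) + ω * r * s * (C * (1 - δ)) := by
          gcongr
          exact hCmp _ hscaled
      _ = _ := by ring
  calc _ ≤ (C * s * (1 - ω * r * δ)) ^ 2 := pow_le_pow_left₀ (lpNorm_nonneg hp _) herror 2
    _ = (1 - 2 * (ω * r * (δ - δ ^ 2 / 2)) - ω * r * (1 - ω * r) * δ ^ 2) * (C * s) ^ 2 := by ring
    _ ≤ _ := by
        have hslack : 0 ≤ ω * r * (1 - ω * r) * δ ^ 2 := by positivity
        exact mul_le_mul_of_nonneg_right (sub_le_self _ hslack) (sq_nonneg _)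

end LpNorm

/-! ### Smooth costs -/

section Smooth

open scoped RealInnerProductSpace

section Hilbert

variable {H : Type*} [NormedAddCommGroup H] [InnerProductSpace ℝ H] [CompleteSpace H] {ell : ℝ}
  {g : H → ℝ}

lemma le_add_inner_gradient_add_sq (hg : Differentiable ℝ g)
    (hlip : ∀ x y, ‖gradient g x - gradient g y‖ ≤ ell * ‖x - y‖) (x v : H) :
    g (x + v) ≤ g x + ⟪gradient g x, v⟫ + ell / 2 * ‖v‖ ^ 2 := by
  have hline (t : ℝ) : HasDerivAt (fun t : ℝ => g (x + t • v)) ⟪gradient g (x + t • v), v⟫ t := by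
    have h : HasDerivAt (fun t : ℝ => x + t • v) v t := by
      simpa using ((hasDerivAt_id t).smul_const v).const_add x
    exact (hg (x + t • v)).hasGradientAt.hasFDerivAt.comp_hasDerivAt t h
  have hbound (t : ℝ) : HasDerivAt
      (fun t => g x + t * ⟪gradient g x, v⟫ + ell / 2 * ‖v‖ ^ 2 * t ^ 2)
      (⟪gradient g x, v⟫ + ell * t * ‖v‖ ^ 2) t := by
    have h := (((hasDerivAt_id t).mul_const ⟪gradient g x, v⟫).const_add (g x)).add
      ((hasDerivAt_pow 2 t).const_mul (ell / 2 * ‖v‖ ^ 2))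
    exact h.congr_deriv (by push_cast; ring)
  have hle := image_le_of_deriv_right_le_deriv_boundary (a := 0) (b := 1)
    (f := fun t : ℝ => g (x + t • v)) (fun t _ => (hline t).continuousAt.continuousWithinAt)
    (fun t _ => (hline t).hasDerivWithinAt) (by simp)
    (fun t _ => (hbound t).continuousAt.continuousWithinAt)
    (fun t _ => (hbound t).hasDerivWithinAt) (fun t ht => ?_) (Set.right_mem_Icc.2 zero_le_one)
  · simpa using hle
  · have hgrad := hlip (x + t • v) x
    rw [add_sub_cancel_left, norm_smul, Real.norm_of_nonneg ht.1] at hgrad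
    rw [← sub_le_iff_le_add', ← inner_sub_left]
    calc _ ≤ ‖gradient g (x + t • v) - gradient g x‖ * ‖v‖ := real_inner_le_norm _ _
      _ ≤ ell * (t * ‖v‖) * ‖v‖ := by gcongr
      _ = ell * t * ‖v‖ ^ 2 := by ring

lemma norm_gradient_sq_le (hg : Differentiable ℝ g)
    (hlip : ∀ x y, ‖gradient g x - gradient g y‖ ≤ ell * ‖x - y‖) (hell : 0 < ell) {m : ℝ}
    (hm : ∀ x, m ≤ g x) (x : H) : ‖gradient g x‖ ^ 2 ≤ 2 * ell * (g x - m) := by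
  have hdescent := (hm _).trans (le_add_inner_gradient_add_sq hg hlip x (-(ell⁻¹ • gradient g x)))
  rw [inner_neg_right, inner_smul_right, norm_neg, norm_smul, real_inner_self_eq_norm_sq, mul_pow,
    Real.norm_eq_abs, sq_abs] at hdescent
  have hgap : ell⁻¹ * ‖gradient g x‖ ^ 2 ≤ 2 * (g x - m) := by
    have : ell / 2 * ((ell⁻¹) ^ 2 * ‖gradient g x‖ ^ 2) = ell⁻¹ * ‖gradient g x‖ ^ 2 / 2 := by
      field_simp
    linarith
  rw [inv_mul_le_iff₀ hell] at hgap
  linarith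

end Hilbert

variable {n d : ℕ} {ell : ℝ} {f : Fin n → Vec d → ℝ}

lemma hasGradientAt_globalCost (hf : ∀ i, Differentiable ℝ (f i)) (x : Vec d) :
    HasGradientAt (globalCost f) (mean fun i => gradient (f i) x) x := by
  rw [hasGradientAt_iff_hasFDerivAt, mean, map_smul, map_sum]
  exact (HasFDerivAt.fun_sum fun i _ =>
    ((hf i) x).hasGradientAt.hasFDerivAt).const_mul (1 / (n : ℝ))

lemma gradient_globalCost (hf : ∀ i, IsSmoothCost ell (f i)) (x : Vec d) :
    gradient (globalCost f) x = mean fun i => gradient (f i) x :=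
  (hasGradientAt_globalCost (fun i => (hf i).1) x).gradient

lemma isSmoothCost_globalCost (hn : n ≠ 0) (hf : ∀ i, IsSmoothCost ell (f i)) :
    IsSmoothCost ell (globalCost f) := by
  refine ⟨fun x => (hasGradientAt_globalCost (fun i => (hf i).1) x).differentiableAt,
    fun x y => ?_⟩
  rw [gradient_globalCost hf, gradient_globalCost hf, mean, mean, ← smul_sub,
    ← Finset.sum_sub_distrib, norm_smul, Real.norm_of_nonneg (by positivity)]
  calc _ ≤ 1 / (n : ℝ) * ∑ _i : Fin n, ell * ‖x - y‖ := by
        gcongr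
        exact norm_sum_le_of_le _ fun i _ => (hf i).2 x y
    _ = _ := by
        simp only [Finset.sum_const, Finset.card_univ, Fintype.card_fin, nsmul_eq_mul]
        field_simp

end Smooth

/-! ### The scalar parameters -/

namespace Params

/-- The standing assumptions on the scalar parameters. -/
structure Admissible (P : Params) : Prop where
  ell_pos : 0 < P.ell
  r_pos : 0 < P.r
  C_pos : 0 < P.C
  δ_pos : 0 < P.δ
  δ_le : P.δ ≤ 1
  ω_pos : 0 < P.ω
  ω_le : P.ω ≤ 1 / P.r
  s₀_pos : 0 < P.s₀
  κ₁_le : P.κ₁ ≤ P.τ₁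
  κ₂_lt : P.κ₂ < P.γ
  κhat₀_pos : 0 < P.κhat₀
  rho2_pos : 0 < P.rho2
  rho2_le : P.rho2 ≤ P.rho

namespace Admissible

variable {P : Params} {α : ℝ} (h : P.Admissible)
include h

lemma rho_pos : 0 < P.rho := h.rho2_pos.trans_le h.rho2_le

lemma five_div_le : 5 / P.rho2 ≤ P.γ :=
  ((le_max_right _ _).trans (le_max_left _ _)).trans h.κ₂_lt.le

lemma γ_pos : 0 < P.γ := (div_pos (by norm_num) h.rho2_pos).trans_le h.five_div_le

lemma four_le : 4 ≤ P.τ₁ * P.rho2 := (div_le_iff₀ h.rho2_pos).1 h.κ₁_le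

lemma τ₁_pos : 0 < P.τ₁ := (div_pos (by norm_num) h.rho2_pos).trans_le h.κ₁_le

lemma β_pos : 0 < P.β := mul_pos h.τ₁_pos h.γ_pos

lemma four_mul_γ_le : 4 * P.γ ≤ P.rho2 * P.β :=
  calc _ ≤ P.τ₁ * P.rho2 * P.γ := mul_le_mul_of_nonneg_right h.four_le h.γ_pos.le
    _ = P.rho2 * P.β := by rw [β]; ring

lemma rho2_mul_le : P.rho2 * P.β * P.γ ≤ P.rho ^ 2 * P.β ^ 2 := by
  have hmono : P.rho2 * P.β ≤ P.rho * P.β := mul_le_mul_of_nonneg_right h.rho2_le h.β_pos.le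
  calc _ ≤ P.rho * P.β * (P.rho * P.β) :=
        mul_le_mul hmono (by linarith [h.four_mul_γ_le, h.γ_pos]) h.γ_pos.le
          (mul_pos h.rho_pos h.β_pos).le
    _ = _ := by ring

lemma φ₂_pos : 0 < P.φ₂ := by
  have hcross := h.rho2_mul_le
  have hγ : 0 ≤ (P.rho + 2) * P.γ ^ 2 := mul_nonneg (by linarith [h.rho_pos]) (sq_nonneg _)
  rw [φ₂]
  linarith [mul_nonneg (sq_nonneg P.rho) (sq_nonneg P.β), sq_nonneg P.ell]

lemma φ₄_pos : 0 < P.φ₄ := by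
  have := h.rho_pos
  rw [φ₄]
  positivity

lemma φ₆_pos : 0 < P.φ₆ := by
  have := h.rho2_pos
  have := h.ell_pos
  have := h.γ_pos
  have := h.β_pos
  rw [φ₆]
  positivity

lemma φ₇_nonneg : 0 ≤ P.φ₇ := by
  have := h.rho_pos
  have := h.γ_pos
  have := h.β_pos
  rw [φ₇]
  positivity

lemma φ₈_nonneg : 0 ≤ P.φ₈ := by
  have hcross := h.rho2_mul_le
  have hγ : 0 ≤ (P.rho + 2) * P.γ ^ 2 := mul_nonneg (by linarith [h.rho_pos]) (sq_nonneg _)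
  have hβγ : 0 ≤ P.rho * P.β * P.γ := mul_nonneg (mul_pos h.rho_pos h.β_pos).le h.γ_pos.le
  rw [φ₈]
  linarith [mul_nonneg (sq_nonneg P.rho) (sq_nonneg P.β)]

lemma mul_φ₂_le (hα : α ≤ P.κhat₀) : α * P.φ₂ ≤ P.φ₁ :=
  (le_div_iff₀ h.φ₂_pos).1 (hα.trans (min_le_left _ _))

lemma mul_φ₄_le (hα : α ≤ P.κhat₀) : α * P.φ₄ ≤ P.φ₃ :=
  (le_div_iff₀ h.φ₄_pos).1 (hα.trans ((min_le_right _ _).trans (min_le_left _ _)))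

lemma mul_φ₆_le (hα : α ≤ P.κhat₀) : α * P.φ₆ ≤ P.φ₅ :=
  (le_div_iff₀ h.φ₆_pos).1 (hα.trans ((min_le_right _ _).trans (min_le_right _ _)))

lemma φ₁_pos : 0 < P.φ₁ := (mul_pos h.κhat₀_pos h.φ₂_pos).trans_le (h.mul_φ₂_le le_rfl)

lemma κ₇_pos : 0 < P.κ₇ := lt_min h.κhat₀_pos (one_div_pos.2 (mul_pos two_pos h.ell_pos))

lemma ψ₂_nonneg (hα : 0 ≤ α) : 0 ≤ P.ψ₂ α :=
  add_nonneg h.φ₇_nonneg (mul_nonneg hα h.φ₈_nonneg)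

lemma ψ₂_mono {α' : ℝ} (hα : α ≤ α') : P.ψ₂ α ≤ P.ψ₂ α' :=
  add_le_add_right (mul_le_mul_of_nonneg_right hα h.φ₈_nonneg) _

lemma ε₁_pos : 0 < P.ε₁ :=
  div_pos (by linarith [h.four_le]) (mul_pos (mul_pos two_pos h.τ₁_pos) h.rho2_pos)

lemma ε₁_le : P.ε₁ ≤ 1 / 2 := by
  rw [ε₁, div_le_div_iff₀ (mul_pos (mul_pos two_pos h.τ₁_pos) h.rho2_pos) two_pos]
  linarith

lemma ω_mul_r_le : P.ω * P.r ≤ 1 := (le_div_iff₀ h.r_pos).1 h.ω_le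

lemma ε₅_pos : 0 < P.ε₅ :=
  mul_pos (mul_pos h.ω_pos h.r_pos) (by nlinarith [h.δ_pos, h.δ_le])

lemma ε₅_le : P.ε₅ ≤ 1 / 2 :=
  calc P.ε₅ ≤ P.ω * P.r * (1 / 2) :=
        mul_le_mul_of_nonneg_left (by linarith [sq_nonneg (P.δ - 1)])
          (mul_pos h.ω_pos h.r_pos).le
    _ ≤ 1 / 2 := by linarith [h.ω_mul_r_le]

lemma one_sub_two_mul_ε₅_nonneg : 0 ≤ 1 - 2 * P.ε₅ := by linarith [h.ε₅_le]

lemma ε₈_pos : 0 < P.ε₈ := by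
  have := h.ε₅_pos
  rw [ε₈]
  positivity

lemma ε₈_le : P.ε₈ ≤ 1 / 2 := by
  rw [ε₈]
  nlinarith [h.ε₅_pos, h.ε₅_le]

lemma ψ₃_nonneg : 0 ≤ P.ψ₃ := by
  have := h.ε₅_pos
  rw [ψ₃]
  positivity

lemma ψ₄_nonneg : 0 ≤ P.ψ₄ := by
  have := h.ε₅_pos
  have := h.ε₁_pos
  have : 0 ≤ max (P.β ^ 2 * P.rho ^ 2 + P.ell ^ 2) (P.γ ^ 2 * P.rho) :=
    le_max_of_le_left (by positivity)
  rw [ψ₄]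
  positivity

end Admissible

end Params

/-! ### One iteration -/

section Step

open scoped RealInnerProductSpace

variable {n d : ℕ}

lemma mean_add (x y : Fin n → Vec d) : mean (fun i => x i + y i) = mean x + mean y := by
  simp only [mean, Finset.sum_add_distrib, smul_add]

lemma mean_sub (x y : Fin n → Vec d) : mean (fun i => x i - y i) = mean x - mean y := by
  simp only [mean, Finset.sum_sub_distrib, smul_sub]

lemma mean_smul (c : ℝ) (x : Fin n → Vec d) : mean (fun i => c • x i) = c • mean x := by
  rw [mean, mean, ← Finset.smul_sum, smul_comm]

lemma norm_stack_sq (x : Fin n → Vec d) : ‖stack x‖ ^ 2 = ∑ i, ‖x i‖ ^ 2 :=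
  PiLp.norm_sq_eq_of_L2 _ _

lemma norm_stack_const_sq (a : Vec d) : ‖stack fun _ : Fin n => a‖ ^ 2 = n * ‖a‖ ^ 2 := by
  rw [norm_stack_sq, Finset.sum_const, Finset.card_univ, Fintype.card_fin, nsmul_eq_mul]

lemma inner_stack_const (a b : Vec d) :
    ⟪stack fun _ : Fin n => a, stack fun _ : Fin n => b⟫ = n * ⟪a, b⟫ := by
  simp only [PiLp.inner_apply, Finset.sum_const, Finset.card_univ, Fintype.card_fin, nsmul_eq_mul]

/-- The consensus error: the total squared distance of the agents' vectors from their average. -/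
noncomputable def consensusError (x : Fin n → Vec d) : ℝ := ∑ i, ‖x i - mean x‖ ^ 2

lemma consensusError_nonneg (x : Fin n → Vec d) : 0 ≤ consensusError x :=
  Finset.sum_nonneg fun _ _ => sq_nonneg _

lemma norm_matAct_matE_stack_sq (x : Fin n → Vec d) :
    ‖matAct (matE n) (stack x)‖ ^ 2 = consensusError x := by
  rw [← sub_sub_cancel (stack x) (matAct (matE n) (stack x)), sub_matAct_matE, matAct_avgMat_stack]
  exact norm_stack_sq fun i => x i - mean x

lemma sub_matAct_matE_stack (x : Fin n → Vec d) :
    stack x - matAct (matE n) (stack x) = stack fun _ => mean x := by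
  rw [sub_matAct_matE, matAct_avgMat_stack]

/-- The deviation `∇f_i(x_i) - ∇f_i(x̄)` of the local gradients from their values at the average. -/
noncomputable def gradDeviation (f : Fin n → Vec d → ℝ) (x : Fin n → Vec d) (i : Fin n) : Vec d :=
  gradient (f i) (x i) - gradient (f i) (mean x)

/-- The squared error of the estimates `x̂_{i,k}` of `x_{i,k}`, computed with scaling factor `s`. -/
noncomputable def compressionError (Cmp : Vec d → Vec d) (ω s : ℝ) (S : AlgState n d) : ℝ :=
  ∑ i, ‖nextXhat Cmp ω s S i - S.x i‖ ^ 2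

/-- The squared distance of the dual variable from its optimal value, weighted by `F`. -/
noncomputable def dualError (L : Matrix (Fin n) (Fin n) ℝ) (lam : ℝ) (f : Fin n → Vec d → ℝ) (γ : ℝ)
    (x v : Fin n → Vec d) : ℝ :=
  wInner (matF L lam) (shiftedDual f γ x v) (shiftedDual f γ x v)

lemma lyapunov_eq (L : Matrix (Fin n) (Fin n) ℝ) (lam : ℝ) (f : Fin n → Vec d → ℝ)
    (β γ flow : ℝ) (x v : Fin n → Vec d) :
    lyapunov L lam f β γ flow x v =
      primalDualEnergy (matAct (matE n)) (matAct (matF L lam)) ((β + γ) / γ) (stack x)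
        (stack (shiftedDual f γ x v)) + (n * globalCost f (mean x) - n * flow) := by
  have hE : wInner (matE n) x x = ‖matAct (matE n) (stack x)‖ ^ 2 := by
    rw [← real_inner_self_eq_norm_sq, inner_matAct_left, matE_transpose, ← Module.End.mul_apply,
      ← map_mul, matE_mul_self, inner_matAct_stack]
  rw [lyapunov, primalDualEnergy, hE, ← Module.End.mul_apply, ← map_mul, inner_matAct_stack,
    inner_matAct_stack]
  ring

/-- The standing assumptions on the network and on the costs. -/
structure IsNetwork (P : Params) (A : Matrix (Fin n) (Fin n) ℝ) (f : Fin n → Vec d → ℝ)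
    (lam : ℝ) : Prop where
  two_le : 2 ≤ n
  connected : IsUndirectedConnected A
  rho_eq : rhoMax (laplacian A) = P.rho
  rho2_eq : rhoTwo (laplacian A) = P.rho2
  lam_mem : lam ∈ Set.Icc P.rho2 P.rho
  smooth : ∀ i, IsSmoothCost P.ell (f i)

/-- The invariants `y_{k-1} = L x̂_{k-1}` and `∑ v_{i,k} = 0` of the algorithm. -/
structure IsConsistent (A : Matrix (Fin n) (Fin n) ℝ) (S : AlgState n d) : Prop where
  y_eq : stack S.y = matAct (laplacian A) (stack S.xhat)
  mean_v : mean S.v = 0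

variable {P : Params} {A : Matrix (Fin n) (Fin n) ℝ} {f : Fin n → Vec d → ℝ} {lam α s ω β γ : ℝ}
  {Cmp : Vec d → Vec d} {S : AlgState n d}

lemma norm_gradDeviation_sq_le {ell : ℝ} (hf : ∀ i, IsSmoothCost ell (f i)) (x : Fin n → Vec d) :
    ‖stack (gradDeviation f x)‖ ^ 2 ≤ ell ^ 2 * ‖matAct (matE n) (stack x)‖ ^ 2 := by
  rw [norm_matAct_matE_stack_sq, norm_stack_sq, consensusError, Finset.mul_sum]
  refine Finset.sum_le_sum fun i _ => ?_
  rw [← mul_pow]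
  exact pow_le_pow_left₀ (norm_nonneg _) ((hf i).2 _ _) 2

lemma norm_gradient_sub_gradient_sq_le {ell : ℝ} (hf : ∀ i, IsSmoothCost ell (f i)) (a b : Vec d) :
    ‖stack fun i => gradient (f i) a - gradient (f i) b‖ ^ 2
      ≤ ell ^ 2 * ‖stack fun _ : Fin n => a - b‖ ^ 2 := by
  rw [norm_stack_sq, norm_stack_sq, Finset.mul_sum]
  refine Finset.sum_le_sum fun i _ => ?_
  rw [← mul_pow]
  exact pow_le_pow_left₀ (norm_nonneg _) ((hf i).2 _ _) 2

lemma mean_gradDeviation {ell : ℝ} (hf : ∀ i, IsSmoothCost ell (f i)) (x : Fin n → Vec d) :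
    mean (gradDeviation f x)
      = mean (fun i => gradient (f i) (x i)) - gradient (globalCost f) (mean x) := by
  rw [gradient_globalCost hf, ← mean_sub]
  rfl

lemma globalCost_sub_smul_le {ell : ℝ} (hn : n ≠ 0) (hf : ∀ i, IsSmoothCost ell (f i)) (α : ℝ)
    (a g : Vec d) :
    n * globalCost f (a - α • g) ≤ n * globalCost f a
      + (-(α * ⟪stack fun _ : Fin n => g, stack fun _ : Fin n => gradient (globalCost f) a⟫)
        + ell / 2 * α ^ 2 * ‖stack fun _ : Fin n => g‖ ^ 2) := by
  have hF := isSmoothCost_globalCost hn hf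
  have hquad := le_add_inner_gradient_add_sq hF.1 hF.2 a (-(α • g))
  rw [← sub_eq_add_neg, inner_neg_right, inner_smul_right, norm_neg, norm_smul, mul_pow,
    Real.norm_eq_abs, sq_abs] at hquad
  rw [inner_stack_const, norm_stack_const_sq, real_inner_comm]
  calc _ ≤ n * (globalCost f a + -(α * ⟪gradient (globalCost f) a, g⟫)
        + ell / 2 * (α ^ 2 * ‖g‖ ^ 2)) := by gcongr
    _ = _ := by ring

lemma IsNetwork.isLaplacianTriple (hN : IsNetwork P A f lam) :
    IsLaplacianTriple (matAct (d := d) (laplacian A)) (matAct (matE n))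
      (matAct (matF (laplacian A) lam)) P.rho2 P.rho lam := by
  rw [← hN.rho_eq, ← hN.rho2_eq]
  refine isLaplacianTriple_matAct d hN.connected hN.two_le ?_
  rw [hN.rho_eq, hN.rho2_eq]
  exact hN.lam_mem

namespace IsConsistent

lemma nextY_eq (hS : IsConsistent A S) (ω s : ℝ) :
    stack (nextY (laplacian A) Cmp ω s S)
      = matAct (laplacian A) (stack (nextXhat Cmp ω s S)) := by
  have hxhat : stack (nextXhat Cmp ω s S)
      = stack S.xhat + (ω * s) • stack (compressed Cmp s S) := rfl
  rw [hxhat, map_add, map_smul, ← hS.y_eq]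
  rfl

lemma mean_nextY (hS : IsConsistent A S) (hA : IsUndirectedConnected A) (ω s : ℝ) :
    mean (nextY (laplacian A) Cmp ω s S) = 0 := by
  have havg : matAct (avgMat n) (stack (nextY (laplacian A) Cmp ω s S)) = 0 := by
    rw [hS.nextY_eq, ← Module.End.mul_apply, ← map_mul, hA.avgMat_mul_laplacian, map_zero,
      LinearMap.zero_apply]
  rw [matAct_avgMat_stack] at havg
  rcases n.eq_zero_or_pos with rfl | hn
  · simp [mean]
  · exact congrArg (fun z : Stacked n d => z ⟨0, hn⟩) havg

lemma algStep (hS : IsConsistent A S) (hA : IsUndirectedConnected A) (α β γ ω s : ℝ) :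
    IsConsistent A (algStep (laplacian A) f Cmp α β γ ω s S) where
  y_eq := hS.nextY_eq ω s
  mean_v := by
    simp only [DistOpt.algStep, mean_add, mean_smul, hS.mean_v, hS.mean_nextY hA, smul_zero,
      add_zero]

lemma mean_algStep_x (hS : IsConsistent A S) (hA : IsUndirectedConnected A) (α β γ ω s : ℝ) :
    mean (DistOpt.algStep (laplacian A) f Cmp α β γ ω s S).x
      = mean S.x - α • mean (fun i => gradient (f i) (S.x i)) := by
  simp only [DistOpt.algStep, mean_sub, mean_smul, mean_add, hS.mean_v, hS.mean_nextY hA, smul_zero,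
    add_zero, zero_add]

lemma mean_shiftedDual (hS : IsConsistent A S) {ell : ℝ} (hf : ∀ i, IsSmoothCost ell (f i))
    (γ : ℝ) : mean (shiftedDual f γ S.x S.v) = γ⁻¹ • gradient (globalCost f) (mean S.x) := by
  have hsplit : shiftedDual f γ S.x S.v = fun i => S.v i + γ⁻¹ • gradient (f i) (mean S.x) := rfl
  rw [hsplit, mean_add, mean_smul, hS.mean_v, zero_add, gradient_globalCost hf]

lemma stack_algStep_x (hS : IsConsistent A S) (hγ : γ ≠ 0) :
    stack (DistOpt.algStep (laplacian A) f Cmp α β γ ω s S).x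
      = stack S.x - α • (β • matAct (laplacian A) (stack (nextXhat Cmp ω s S))
        + γ • stack (shiftedDual f γ S.x S.v) + stack (gradDeviation f S.x)) := by
  rw [← hS.nextY_eq]
  ext i : 1
  simp only [DistOpt.algStep, PiLp.sub_apply, PiLp.add_apply, PiLp.smul_apply, shiftedDual,
    gradDeviation, smul_add γ, smul_inv_smul₀ hγ]
  abel_nf

lemma stack_shiftedDual_algStep (hS : IsConsistent A S) :
    stack (shiftedDual f γ (DistOpt.algStep (laplacian A) f Cmp α β γ ω s S).x
        (DistOpt.algStep (laplacian A) f Cmp α β γ ω s S).v)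
      = stack (shiftedDual f γ S.x S.v)
        + (α * γ) • matAct (laplacian A) (stack (nextXhat Cmp ω s S))
        + γ⁻¹ • stack fun i => gradient (f i)
              (mean (DistOpt.algStep (laplacian A) f Cmp α β γ ω s S).x)
            - gradient (f i) (mean S.x) := by
  rw [← hS.nextY_eq]
  ext i : 1
  simp only [PiLp.add_apply, PiLp.smul_apply, shiftedDual, smul_sub]
  simp only [DistOpt.algStep]
  abel

end IsConsistent

/-- The guaranteed decrease of the Lyapunov function in a step from `x` without compression. -/
noncomputable def Params.decrement (P : Params) (f : Fin n → Vec d → ℝ) (α : ℝ)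
    (x : Fin n → Vec d) : ℝ :=
  α * (P.φ₁ - α * P.φ₂) * consensusError x
    + 3 / 40 * α * (n * ‖gradient (globalCost f) (mean x)‖ ^ 2)

/-- The Lyapunov function as a function of the state of the algorithm. -/
noncomputable def Params.lyapunovAt (P : Params) (A : Matrix (Fin n) (Fin n) ℝ) (lam : ℝ)
    (f : Fin n → Vec d → ℝ) (flow : ℝ) (S : AlgState n d) : ℝ :=
  lyapunov (laplacian A) lam f P.β P.γ flow S.x S.v

theorem lyapunovAt_algStep_add_decrement_le (hP : P.Admissible) (hN : IsNetwork P A f lam)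
    (hS : IsConsistent A S) (hα : 0 < α) (hακ : α ≤ P.κhat₀) (flow s : ℝ) :
    P.lyapunovAt A lam f flow (algStep (laplacian A) f Cmp α P.β P.γ P.ω s S)
        + P.decrement f α S.x
      ≤ P.lyapunovAt A lam f flow S + α * P.ψ₂ α * compressionError Cmp P.ω s S := by
  have T := hN.isLaplacianTriple
  set g := mean fun i => gradient (f i) (S.x i)
  have hmean := hS.mean_algStep_x (f := f) (Cmp := Cmp) hN.connected α P.β P.γ P.ω s
  have hw : stack (shiftedDual f P.γ S.x S.v) - matAct (matE n) (stack (shiftedDual f P.γ S.x S.v))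
      = P.γ⁻¹ • stack fun _ : Fin n => gradient (globalCost f) (mean S.x) := by
    rw [sub_matAct_matE_stack, hS.mean_shiftedDual hN.smooth]
    rfl
  have he := norm_gradDeviation_sq_le hN.smooth S.x
  have hg : ‖(stack fun _ : Fin n => g)
      - stack fun _ : Fin n => gradient (globalCost f) (mean S.x)‖ ^ 2
      ≤ P.ell ^ 2 * ‖matAct (matE n) (stack S.x)‖ ^ 2 := by
    refine (Eq.trans_le ?_ (T.norm_sub_E_sq_le (stack (gradDeviation f S.x)))).trans he
    rw [sub_matAct_matE_stack, mean_gradDeviation hN.smooth]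
    rfl
  have hh := norm_gradient_sub_gradient_sq_le hN.smooth
    (mean (algStep (laplacian A) f Cmp α P.β P.γ P.ω s S).x) (mean S.x)
  have hshift : ‖stack fun _ : Fin n =>
      mean (algStep (laplacian A) f Cmp α P.β P.γ P.ω s S).x - mean S.x‖ ^ 2
      = α ^ 2 * ‖stack fun _ : Fin n => g‖ ^ 2 := by
    rw [norm_stack_const_sq, norm_stack_const_sq, hmean, sub_sub_cancel_left, norm_neg, norm_smul,
      mul_pow, Real.norm_eq_abs, sq_abs, mul_left_comm]
  rw [hshift, mul_left_comm] at hh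
  have hcost := globalCost_sub_smul_le (by linarith [hN.two_le]) hN.smooth α (mean S.x) g
  have hdescent := T.energy_descent hα hP.four_mul_γ_le hP.five_div_le
    (z := stack (nextXhat Cmp P.ω s S)) hw he hg hh
  have hφ₃ := mul_nonneg (mul_nonneg hα.le (sub_nonneg.2 (hP.mul_φ₄_le hακ)))
    (T.inner_EF_nonneg (stack (shiftedDual f P.γ S.x S.v)))
  have hφ₅ := mul_nonneg (mul_nonneg hα.le (sub_nonneg.2 (hP.mul_φ₆_le hακ)))
    (sq_nonneg ‖stack fun _ : Fin n => g‖)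
  have hcomp : ‖stack (nextXhat Cmp P.ω s S) - stack S.x‖ ^ 2 = compressionError Cmp P.ω s S :=
    norm_stack_sq fun i => nextXhat Cmp P.ω s S i - S.x i
  rw [← hS.stack_algStep_x hP.γ_pos.ne', ← hS.stack_shiftedDual_algStep, hcomp,
    norm_matAct_matE_stack_sq, norm_stack_const_sq (gradient _ _)] at hdescent
  rw [Params.lyapunovAt, Params.lyapunovAt, lyapunov_eq, lyapunov_eq, hmean, Params.decrement]
  linarith

theorem le_lyapunovAt (hP : P.Admissible) (hN : IsNetwork P A f lam) (flow : ℝ)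
    (S : AlgState n d) :
    P.ε₁ * (consensusError S.x + dualError (laplacian A) lam f P.γ S.x S.v)
      + n * (globalCost f (mean S.x) - flow) ≤ P.lyapunovAt A lam f flow S := by
  have T := hN.isLaplacianTriple
  set w := stack (shiftedDual f P.γ S.x S.v)
  have henergy := T.energy_lower_bound hP.τ₁_pos (stack S.x) w
  have hdual := mul_le_mul_of_nonneg_right hP.ε₁_le (T.inner_F_nonneg w)
  have hτ₁ : (P.β + P.γ) / P.γ = P.τ₁ + 1 := by
    rw [Params.β, add_div, mul_div_cancel_right₀ _ hP.γ_pos.ne', div_self hP.γ_pos.ne']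
  rw [← Params.ε₁, norm_matAct_matE_stack_sq] at henergy
  rw [Params.lyapunovAt, lyapunov_eq, hτ₁, dualError, ← inner_matAct_stack]
  linarith

lemma dualError_nonneg (hN : IsNetwork P A f lam) (γ : ℝ) (x v : Fin n → Vec d) :
    0 ≤ dualError (laplacian A) lam f γ x v := by
  rw [dualError, ← inner_matAct_stack]
  exact hN.isLaplacianTriple.inner_F_nonneg _

theorem sum_norm_algStep_sub_sq_le (hP : P.Admissible) (hN : IsNetwork P A f lam)
    (hS : IsConsistent A S) (α s : ℝ) :
    ∑ i, ‖(algStep (laplacian A) f Cmp α P.β P.γ P.ω s S).x i - S.x i‖ ^ 2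
      ≤ α ^ 2 * (4 * (P.β ^ 2 * P.rho ^ 2) * compressionError Cmp P.ω s S
        + 4 * max (P.β ^ 2 * P.rho ^ 2 + P.ell ^ 2) (P.γ ^ 2 * P.rho)
          * (consensusError S.x + dualError (laplacian A) lam f P.γ S.x S.v)) := by
  have T := hN.isLaplacianTriple
  set x := stack S.x
  set z := stack (nextXhat Cmp P.ω s S)
  set w := stack (shiftedDual f P.γ S.x S.v)
  have hstep : (stack fun i => (algStep (laplacian A) f Cmp α P.β P.γ P.ω s S).x i - S.x i)
      = (-α) • (P.β • matAct (laplacian A) (z - x) + P.β • matAct (laplacian A) x + P.γ • w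
        + stack (gradDeviation f S.x)) :=
    calc _ = stack (algStep (laplacian A) f Cmp α P.β P.γ P.ω s S).x - x := rfl
      _ = _ := by
        rw [hS.stack_algStep_x hP.γ_pos.ne', sub_sub_cancel_left, ← neg_smul, map_sub, ← smul_add,
          sub_add_cancel]
  have hL (y : Stacked n d) : ‖P.β • matAct (laplacian A) y‖ ^ 2
      ≤ P.β ^ 2 * P.rho ^ 2 * ‖matAct (matE n) y‖ ^ 2 := by
    rw [norm_smul, Real.norm_eq_abs, mul_pow, sq_abs, mul_assoc, ← mul_pow P.rho]
    gcongr
    exact T.norm_L_le y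
  have hz_sub : ‖P.β • matAct (laplacian A) (z - x)‖ ^ 2
      ≤ P.β ^ 2 * P.rho ^ 2 * compressionError Cmp P.ω s S :=
    (hL _).trans (mul_le_mul_of_nonneg_left ((T.norm_E_sq_le _).trans_eq
      (norm_stack_sq fun i => nextXhat Cmp P.ω s S i - S.x i)) (by positivity))
  have hLx := hL x
  have hγw : ‖P.γ • w‖ ^ 2 ≤ P.γ ^ 2 * P.rho * dualError (laplacian A) lam f P.γ S.x S.v := by
    rw [norm_smul, Real.norm_eq_abs, mul_pow, sq_abs, mul_assoc, dualError, ← inner_matAct_stack]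
    gcongr
    exact T.norm_sq_le_inner_F w
  have he := norm_gradDeviation_sq_le hN.smooth S.x
  rw [norm_matAct_matE_stack_sq] at he hLx
  have hmaxl := mul_le_mul_of_nonneg_right
    (le_max_left (P.β ^ 2 * P.rho ^ 2 + P.ell ^ 2) (P.γ ^ 2 * P.rho)) (consensusError_nonneg S.x)
  have hmaxr := mul_le_mul_of_nonneg_right
    (le_max_right (P.β ^ 2 * P.rho ^ 2 + P.ell ^ 2) (P.γ ^ 2 * P.rho))
    (dualError_nonneg hN P.γ S.x S.v)
  rw [← norm_stack_sq, hstep, norm_smul, mul_pow, norm_neg, Real.norm_eq_abs, sq_abs]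
  refine mul_le_mul_of_nonneg_left ((norm_add_four_sq_le _ _ _ _).trans ?_) (sq_nonneg α)
  linarith

end Step

/-! ### The run of the algorithm -/

section Run

variable {n d : ℕ}

lemma add_sq_le_of_pos {ε : ℝ} (hε : 0 < ε) (a b : ℝ) :
    (a + b) ^ 2 ≤ (1 + ε) * a ^ 2 + (1 + ε⁻¹) * b ^ 2 := by
  have hsq : 0 ≤ ε⁻¹ * (ε * a - b) ^ 2 := by positivity
  have hexpand : ε⁻¹ * (ε * a - b) ^ 2 = ε * a ^ 2 - 2 * a * b + ε⁻¹ * b ^ 2 := by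
    field_simp
    ring
  linarith

/-- With scaling factor `s`, the argument of the compressor at `S` has `ℓ_p`-norm at most `C`. -/
def InRange (p : ℝ≥0∞) (C s : ℝ) (S : AlgState n d) : Prop :=
  ∀ i, lpNorm p (S.x i - S.xhat i) ≤ C * s

variable {P : Params} {A : Matrix (Fin n) (Fin n) ℝ} {f : Fin n → Vec d → ℝ}
  {lam flow L0 α κ : ℝ} {p : ℝ≥0∞} {Cmp : Vec d → Vec d} {S : AlgState n d} {T k : ℕ}

lemma lpNorm_sub_nextXhat_sq_le (hP : P.Admissible) (hp : 1 ≤ p)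
    (hCmp : IsLocallyBounded p P.r P.C P.δ Cmp) {s : ℝ} (hs : 0 < s) (hS : InRange p P.C s S)
    (i : Fin n) :
    lpNorm p (S.x i - nextXhat Cmp P.ω s S i) ^ 2 ≤ (1 - 2 * P.ε₅) * (P.C * s) ^ 2 := by
  rw [nextXhat, ← sub_sub]
  exact lpNorm_sub_compress_sq_le hp hP.r_pos hP.ω_pos hP.ω_le hs hCmp (hS i)

lemma compressionError_le (hP : P.Admissible) (hp : 1 ≤ p)
    (hCmp : IsLocallyBounded p P.r P.C P.δ Cmp) {s : ℝ} (hs : 0 < s) (hS : InRange p P.C s S) :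
    compressionError Cmp P.ω s S ≤ (1 - 2 * P.ε₅) * (n * dTilde p d ^ 2 * P.C ^ 2) * s ^ 2 :=
  calc compressionError Cmp P.ω s S
      ≤ ∑ _i : Fin n, dTilde p d ^ 2 * ((1 - 2 * P.ε₅) * (P.C * s) ^ 2) := by
        refine Finset.sum_le_sum fun i _ => ?_
        calc _ ≤ (dTilde p d * lpNorm p (S.x i - nextXhat Cmp P.ω s S i)) ^ 2 := by
              rw [norm_sub_rev]
              gcongr
              exact norm_le_dTilde_mul hp _
          _ = dTilde p d ^ 2 * lpNorm p (S.x i - nextXhat Cmp P.ω s S i) ^ 2 := mul_pow _ _ _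
          _ ≤ _ := by gcongr; exact lpNorm_sub_nextXhat_sq_le hP hp hCmp hs hS i
    _ = _ := by
        rw [Finset.sum_const, Finset.card_univ, Fintype.card_fin, nsmul_eq_mul]
        ring

lemma lpNorm_algStep_sub_sq_le (hP : P.Admissible) (hN : IsNetwork P A f lam) (hp : 1 ≤ p)
    (hdhat : dHat p d = P.dhat) (hflow : ∀ x, flow ≤ globalCost f x) (hS : IsConsistent A S)
    (α s : ℝ) (i : Fin n) :
    (1 + P.ε₅⁻¹)
        * lpNorm p ((algStep (laplacian A) f Cmp α P.β P.γ P.ω s S).x i - S.x i) ^ 2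
      ≤ α ^ 2 * (P.ψ₃ * compressionError Cmp P.ω s S + P.ψ₄ * P.lyapunovAt A lam f flow S) := by
  have hε₁ := hP.ε₁_pos
  have hε₅ := hP.ε₅_pos
  have hψ₄ := hP.ψ₄_nonneg
  set Δ := fun i => (algStep (laplacian A) f Cmp α P.β P.γ P.ω s S).x i - S.x i
  set m := max (P.β ^ 2 * P.rho ^ 2 + P.ell ^ 2) (P.γ ^ 2 * P.rho) with hm
  set W := consensusError S.x + dualError (laplacian A) lam f P.γ S.x S.v
  have hΔ : ‖Δ i‖ ^ 2
      ≤ α ^ 2 * (4 * (P.β ^ 2 * P.rho ^ 2) * compressionError Cmp P.ω s S + 4 * m * W) :=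
    (Finset.single_le_sum (f := fun i => ‖Δ i‖ ^ 2) (fun _ _ => sq_nonneg _)
      (Finset.mem_univ i)).trans (sum_norm_algStep_sub_sq_le hP hN hS α s)
  have hW : P.ε₁ * W ≤ P.lyapunovAt A lam f flow S := by
    have hgap : 0 ≤ n * (globalCost f (mean S.x) - flow) :=
      mul_nonneg n.cast_nonneg (sub_nonneg.2 (hflow _))
    linarith [le_lyapunovAt hP hN flow S]
  calc (1 + P.ε₅⁻¹) * lpNorm p (Δ i) ^ 2 ≤ (1 + P.ε₅⁻¹) * (P.dhat * ‖Δ i‖) ^ 2 := by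
        rw [← hdhat]
        gcongr
        · exact lpNorm_nonneg hp _
        · exact lpNorm_le_dHat_mul hp _
    _ = (1 + P.ε₅⁻¹) * P.dhat ^ 2 * ‖Δ i‖ ^ 2 := by ring
    _ ≤ (1 + P.ε₅⁻¹) * P.dhat ^ 2 * (α ^ 2 * (4 * (P.β ^ 2 * P.rho ^ 2)
          * compressionError Cmp P.ω s S + 4 * m * W)) := by gcongr
    _ = α ^ 2 * (P.ψ₃ * compressionError Cmp P.ω s S + P.ψ₄ * (P.ε₁ * W)) := by
        rw [Params.ψ₃, Params.ψ₄, ← hm]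
        field_simp
    _ ≤ _ := by gcongr

lemma inRange_algStep (hP : P.Admissible) (hN : IsNetwork P A f lam) (hp : 1 ≤ p)
    (hdhat : dHat p d = P.dhat) (hflow : ∀ x, flow ≤ globalCost f x)
    (hCmp : IsLocallyBounded p P.r P.C P.δ Cmp) (hS : IsConsistent A S) {s s' : ℝ} (hs : 0 < s)
    (hr : InRange p P.C s S) (hα : (1 - 2 * P.ε₅) * P.ψ₃ * (α ^ 2 * (n * dTilde p d ^ 2)) ≤ P.ε₈)
    (hκ : α ^ 2 * (P.ψ₄ * P.lyapunovAt A lam f flow S) ≤ P.C ^ 2 * κ) (hs' : 0 ≤ s')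
    (hss' : s' ^ 2 = (1 - P.ε₈) * s ^ 2 + κ) :
    InRange p P.C s' (algStep (laplacian A) f Cmp α P.β P.γ P.ω s S) := by
  intro i
  have hψ₃ := hP.ψ₃_nonneg
  have hε₅ := hP.ε₅_pos
  set S' := algStep (laplacian A) f Cmp α P.β P.γ P.ω s S
  have herror := lpNorm_sub_nextXhat_sq_le hP hp hCmp hs hr i
  have hstep := lpNorm_algStep_sub_sq_le (Cmp := Cmp) hP hN hp hdhat hflow hS α s i
  have hcomp : α ^ 2 * (P.ψ₃ * compressionError Cmp P.ω s S) ≤ P.ε₈ * (P.C * s) ^ 2 :=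
    calc _ ≤ α ^ 2 * (P.ψ₃ * ((1 - 2 * P.ε₅) * (n * dTilde p d ^ 2 * P.C ^ 2) * s ^ 2)) := by
          gcongr
          exact compressionError_le hP hp hCmp hs hr
      _ = (1 - 2 * P.ε₅) * P.ψ₃ * (α ^ 2 * (n * dTilde p d ^ 2)) * (P.C * s) ^ 2 := by ring
      _ ≤ _ := by gcongr
  have hcontract : (1 + P.ε₅) * (1 - 2 * P.ε₅) = 1 - 2 * P.ε₈ := by
    rw [Params.ε₈]
    ring
  refine le_of_sq_le_sq ?_ (mul_nonneg hP.C_pos.le hs')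
  calc lpNorm p (S'.x i - nextXhat Cmp P.ω s S i) ^ 2
      = lpNorm p (S.x i - nextXhat Cmp P.ω s S i + (S'.x i - S.x i)) ^ 2 := by
        rw [add_comm, sub_add_sub_cancel]
    _ ≤ (lpNorm p (S.x i - nextXhat Cmp P.ω s S i) + lpNorm p (S'.x i - S.x i)) ^ 2 := by
        gcongr
        · exact lpNorm_nonneg hp _
        · exact lpNorm_add_le hp _ _
    _ ≤ (1 + P.ε₅) * lpNorm p (S.x i - nextXhat Cmp P.ω s S i) ^ 2
          + (1 + P.ε₅⁻¹) * lpNorm p (S'.x i - S.x i) ^ 2 := add_sq_le_of_pos hε₅ _ _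
    _ ≤ (1 + P.ε₅) * ((1 - 2 * P.ε₅) * (P.C * s) ^ 2)
          + (P.ε₈ * (P.C * s) ^ 2 + P.C ^ 2 * κ) := by gcongr; linarith
    _ = (P.C * s') ^ 2 := by
        rw [← mul_assoc, hcontract, mul_pow P.C s', hss']
        ring

/-- The setting of the convergence analysis: `run` is a trajectory of the algorithm with stepsize
`α` and scaling factors `s` that starts in the range of the compressor. -/
structure IsTrajectory (P : Params) (p : ℝ≥0∞) (A : Matrix (Fin n) (Fin n) ℝ)
    (f : Fin n → Vec d → ℝ) (lam flow : ℝ) (Cmp : Vec d → Vec d) (α : ℝ) (s : ℕ → ℝ)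
    (run : ℕ → AlgState n d) : Prop where
  network : IsNetwork P A f lam
  one_le_p : 1 ≤ p
  dHat_eq : dHat p d = P.dhat
  flow_le : ∀ x, flow ≤ globalCost f x
  locallyBounded : IsLocallyBounded p P.r P.C P.δ Cmp
  isConsistent_zero : IsConsistent A (run 0)
  inRange_zero : InRange p P.C (s 0) (run 0)
  succ : ∀ k, run (k + 1) = algStep (laplacian A) f Cmp α P.β P.γ P.ω (s k) (run k)

/-- The conditions on the stepsize and the scaling factors under which the compressor stays in
range for `T` steps, if the Lyapunov function is at most `L0` initially. -/
structure IsSchedule (P : Params) (n T : ℕ) (dt L0 α κ : ℝ) (s : ℕ → ℝ) : Prop where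
  α_pos : 0 < α
  α_le : α ≤ P.κhat₀
  pos : ∀ k, 0 < s k
  le : ∀ k, s k ≤ P.s₀
  sq_succ : ∀ k, s (k + 1) ^ 2 = (1 - P.ε₈) * s k ^ 2 + κ
  ψ₃_le : (1 - 2 * P.ε₅) * P.ψ₃ * (α ^ 2 * (n * dt ^ 2)) ≤ P.ε₈
  le_κ : α ^ 2 * (P.ψ₄ * (L0 + α * P.ψ₂ α * ((1 - 2 * P.ε₅) * (n * dt ^ 2 * P.C ^ 2)
    * (T * P.s₀ ^ 2)))) ≤ P.C ^ 2 * κ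

variable {s : ℕ → ℝ} {run : ℕ → AlgState n d}

lemma IsSchedule.sum_sq_le {dt : ℝ} (hs : IsSchedule P n T dt L0 α κ s)
    (hk : k ≤ T) : ∑ j ∈ Finset.range k, s j ^ 2 ≤ T * P.s₀ ^ 2 :=
  calc _ ≤ ∑ _j ∈ Finset.range k, P.s₀ ^ 2 :=
        Finset.sum_le_sum fun j _ => pow_le_pow_left₀ (hs.pos j).le (hs.le j) 2
    _ = k * P.s₀ ^ 2 := by rw [Finset.sum_const, Finset.card_range, nsmul_eq_mul]
    _ ≤ _ := by gcongr

lemma decrement_nonneg (hP : P.Admissible) (hα : 0 ≤ α) (hακ : α ≤ P.κhat₀) (x : Fin n → Vec d) :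
    0 ≤ P.decrement f α x := by
  have hφ := sub_nonneg.2 (hP.mul_φ₂_le hακ)
  have hx := consensusError_nonneg x
  rw [Params.decrement]
  positivity

namespace IsTrajectory

variable (hr : IsTrajectory P p A f lam flow Cmp α s run)
include hr

lemma isConsistent (k : ℕ) : IsConsistent A (run k) := by
  induction k with
  | zero => exact hr.isConsistent_zero
  | succ k ih =>
    rw [hr.succ]
    exact ih.algStep hr.network.connected _ _ _ _ _

lemma lyapunovAt_add_sum_decrement_le (hP : P.Admissible)
    (hs : IsSchedule P n T (dTilde p d) L0 α κ s) (h0 : P.lyapunovAt A lam f flow (run 0) ≤ L0)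
    (hrange : ∀ j < k, InRange p P.C (s j) (run j)) :
    P.lyapunovAt A lam f flow (run k) + ∑ j ∈ Finset.range k, P.decrement f α (run j).x
      ≤ L0 + α * P.ψ₂ α * ((1 - 2 * P.ε₅) * (n * dTilde p d ^ 2 * P.C ^ 2)
        * ∑ j ∈ Finset.range k, s j ^ 2) := by
  induction k with
  | zero => simpa using h0
  | succ k ih =>
    have hcomp := mul_le_mul_of_nonneg_left
      (compressionError_le hP hr.one_le_p hr.locallyBounded (hs.pos k) (hrange k k.lt_succ_self))
      (mul_nonneg hs.α_pos.le (hP.ψ₂_nonneg hs.α_pos.le))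
    have hdescent := lyapunovAt_algStep_add_decrement_le (Cmp := Cmp) hP hr.network
      (hr.isConsistent k) hs.α_pos hs.α_le flow (s k)
    rw [← hr.succ k] at hdescent
    rw [Finset.sum_range_succ, Finset.sum_range_succ]
    linarith [ih fun j hj => hrange j (hj.trans k.lt_succ_self)]

theorem inRange (hP : P.Admissible) (hs : IsSchedule P n T (dTilde p d) L0 α κ s)
    (h0 : P.lyapunovAt A lam f flow (run 0) ≤ L0) (hk : k ≤ T) :
    InRange p P.C (s k) (run k) := by
  induction k using Nat.strong_induction_on with
  | h k ih =>
    cases k with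
    | zero => exact hr.inRange_zero
    | succ k =>
      have hα := hs.α_pos.le
      have hψ₂ := hP.ψ₂_nonneg hα
      have hψ₄ := hP.ψ₄_nonneg
      have hε₅ := hP.one_sub_two_mul_ε₅_nonneg
      have hdec : 0 ≤ ∑ j ∈ Finset.range k, P.decrement f α (run j).x :=
        Finset.sum_nonneg fun j _ => decrement_nonneg hP hα hs.α_le _
      have hgrowth := hr.lyapunovAt_add_sum_decrement_le hP hs h0
        fun j hj => ih j (hj.trans k.lt_succ_self) (by omega)
      have hV : P.lyapunovAt A lam f flow (run k) ≤ L0 + α * P.ψ₂ α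
          * ((1 - 2 * P.ε₅) * (n * dTilde p d ^ 2 * P.C ^ 2) * (T * P.s₀ ^ 2)) :=
        calc _ ≤ _ := (le_add_of_nonneg_right hdec).trans hgrowth
          _ ≤ _ := by gcongr; exact hs.sum_sq_le (by omega)
      rw [hr.succ]
      refine inRange_algStep hP hr.network hr.one_le_p hr.dHat_eq hr.flow_le hr.locallyBounded
        (hr.isConsistent k) (hs.pos k) (ih k k.lt_succ_self (by omega)) hs.ψ₃_le ?_
        (hs.pos (k + 1)).le (hs.sq_succ k)
      exact le_trans (by gcongr) hs.le_κ

end IsTrajectory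

end Run

/-! ### Tuning of the stepsize and the scaling factors -/

section Tuning

/-- What the threshold `κ̃₃ < T` with parameter `κ = κ̂₃` says about the stepsize `α`. -/
structure IsTuned (P : Params) (n T : ℕ) (dt L0 κ α : ℝ) : Prop where
  α_pos : 0 < α
  α_le : α ≤ P.κhat₀
  sq_mul : α ^ 2 * (√(n : ℝ) * dt ^ 2 * T) = 1
  ψ₃_le : (1 - 2 * P.ε₅) * P.ψ₃ * (α ^ 2 * (n * dt ^ 2)) ≤ P.ε₈
  L0_le : 2 * P.ψ₄ * L0 * α ^ 2 ≤ P.ε₈ * P.C ^ 2 * P.s₀ ^ 2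
  ψ₂_le : 2 * (1 - 2 * P.ε₅) * P.ψ₂ α * P.ψ₄ * (α * √(n : ℝ)) ≤ P.ε₈
  κ_le : κ * (α * dt ^ 2) ^ 2 ≤ 1

variable {P : Params} {n T : ℕ} {dt L0 κ : ℝ}

lemma stepsize_sq_mul (hn : 0 < n) (hdt : 0 < dt) (hT : 0 < T) :
    stepsize n dt T ^ 2 * (√(n : ℝ) * dt ^ 2 * T) = 1 := by
  have hn' : (0 : ℝ) < n := by exact_mod_cast hn
  have hT' : (0 : ℝ) < T := by exact_mod_cast hT
  have hroot : ((n : ℝ) ^ (1 / 4 : ℝ)) ^ 2 = √(n : ℝ) := by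
    rw [← Real.rpow_natCast, ← Real.rpow_mul hn'.le, Real.sqrt_eq_rpow]
    norm_num
  rw [stepsize, div_pow, one_pow, mul_pow, mul_pow, hroot, Real.sq_sqrt hT'.le]
  exact one_div_mul_cancel (by positivity)

lemma rate_eq_one_div_stepsize_mul (hn : 0 < n) (hdt : 0 < dt) (hT : 0 < T) :
    (n : ℝ) ^ (1 / 4 : ℝ) * dt / √(T : ℝ) = 1 / (stepsize n dt T * T) := by
  have hT' : (0 : ℝ) < T := by exact_mod_cast hT
  have hsqrt : (T : ℝ) = √(T : ℝ) * √(T : ℝ) := (Real.mul_self_sqrt hT'.le).symm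
  rw [stepsize]
  conv_rhs => rw [hsqrt, Real.sqrt_mul_self (Real.sqrt_nonneg _)]
  field_simp

theorem isTuned_stepsize (hP : P.Admissible) (hn : 0 < n) (hdt : 0 < dt) (hκ : 0 < κ)
    (hT : P.κtilde₃ n dt κ L0 T < T) : IsTuned P n T dt L0 κ (stepsize n dt T) := by
  have hn' : (0 : ℝ) < n := by exact_mod_cast hn
  rw [Params.κtilde₃, max_lt_iff, max_lt_iff, max_lt_iff, max_lt_iff] at hT
  obtain ⟨hTκ₇, hTψ₃, hTL0, hTψ₂, hTκ⟩ := hT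
  have hT' : (0 : ℝ) < T := lt_of_le_of_lt (by positivity) hTκ
  have hα : 0 < stepsize n dt T := by
    rw [stepsize]
    positivity
  have hsq := stepsize_sq_mul hn hdt (by exact_mod_cast hT')
  have hnn : √(n : ℝ) ^ 2 = n := Real.sq_sqrt hn'.le
  have : 0 < √(n : ℝ) := Real.sqrt_pos.2 hn'
  have hε₈ := hP.ε₈_pos
  have hC := hP.C_pos
  have hs₀ := hP.s₀_pos
  have hκ₇ := hP.κ₇_pos
  set α := stepsize n dt T
  have hmul : ∀ b < (T : ℝ), α ^ 2 * (√(n : ℝ) * dt ^ 2) * b < 1 := fun b hb =>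
    calc _ < α ^ 2 * (√(n : ℝ) * dt ^ 2) * T := by gcongr
      _ = 1 := by rw [mul_assoc, hsq]
  refine ⟨hα, ?_, hsq, ?_, ?_, ?_, ?_⟩
  · have hlt : (α / P.κ₇) ^ 2 < 1 := by
      refine Eq.trans_lt ?_ (hmul _ hTκ₇)
      field_simp
    exact ((div_lt_one hκ₇).1 ((sq_lt_one_iff₀ (by positivity)).1 hlt)).le.trans (min_le_left _ _)
  · refine ((div_lt_one hε₈).1 (Eq.trans_lt ?_ (hmul _ hTψ₃))).le
    field_simp
    rw [hnn]
  · refine ((div_lt_one (by positivity)).1 (Eq.trans_lt ?_ (hmul _ hTL0))).le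
    field_simp
    rw [hnn]
  · refine ((div_lt_one hε₈).1 (lt_of_abs_lt ((sq_lt_one_iff_abs_lt_one _).1
      (Eq.trans_lt ?_ (hmul _ hTψ₂))))).le
    field_simp
    ring
  · refine (Eq.trans_lt ?_ (hmul _ hTκ)).le
    field_simp

namespace IsTuned

variable (h : IsTuned P n T dt L0 κ (stepsize n dt T))
include h

lemma T_pos : 0 < T := by
  refine Nat.pos_of_ne_zero fun hT => ?_
  have hsq := h.sq_mul
  simp [hT] at hsq

lemma κtilde₄_eq : P.κtilde₄ n dt L0 T = P.ψ₄ * L0 * stepsize n dt T ^ 2 / P.C ^ 2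
    + (1 - 2 * P.ε₅) * P.ψ₂ (stepsize n dt T) * P.ψ₄ * (stepsize n dt T * √(n : ℝ))
      * P.s₀ ^ 2 := by
  have hnn : √(n : ℝ) * √(n : ℝ) = n := Real.mul_self_sqrt n.cast_nonneg
  rw [Params.κtilde₄]
  linear_combination ((1 - 2 * P.ε₅) * P.ψ₂ (stepsize n dt T) * P.ψ₄
    * (stepsize n dt T * √(n : ℝ)) * P.s₀ ^ 2) * h.sq_mul - (1 - 2 * P.ε₅)
    * P.ψ₂ (stepsize n dt T) * P.ψ₄ * dt ^ 2 * P.s₀ ^ 2 * stepsize n dt T ^ 3 * T * hnn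

variable (hP : P.Admissible)
include hP

lemma κtilde₄_le : P.κtilde₄ n dt L0 T ≤ P.ε₈ * P.s₀ ^ 2 := by
  have hC := hP.C_pos
  have hL0 : P.ψ₄ * L0 * stepsize n dt T ^ 2 / P.C ^ 2 ≤ P.ε₈ * P.s₀ ^ 2 / 2 := by
    rw [div_le_iff₀ (by positivity)]
    linarith [h.L0_le]
  rw [h.κtilde₄_eq]
  linarith [mul_le_mul_of_nonneg_right h.ψ₂_le (sq_nonneg P.s₀)]

lemma scalingSq_le (k : ℕ) : P.scalingSq n dt L0 T k ≤ P.s₀ ^ 2 := by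
  induction k with
  | zero => exact le_rfl
  | succ k ih =>
    have hcontract : (1 - P.ε₈) * P.scalingSq n dt L0 T k ≤ (1 - P.ε₈) * P.s₀ ^ 2 :=
      mul_le_mul_of_nonneg_left ih (by linarith [hP.ε₈_le])
    rw [Params.scalingSq]
    linarith [h.κtilde₄_le hP]

variable (hL0 : 0 ≤ L0)
include hL0

lemma κtilde₄_nonneg : 0 ≤ P.κtilde₄ n dt L0 T := by
  have hψ₄ := hP.ψ₄_nonneg
  have hψ₂ := hP.ψ₂_nonneg h.α_pos.le
  have hε₅ := hP.one_sub_two_mul_ε₅_nonneg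
  have hα := h.α_pos
  rw [h.κtilde₄_eq]
  positivity

lemma scalingSq_pos (k : ℕ) : 0 < P.scalingSq n dt L0 T k := by
  induction k with
  | zero => exact pow_pos hP.s₀_pos 2
  | succ k ih =>
    exact add_pos_of_pos_of_nonneg (mul_pos (by linarith [hP.ε₈_le]) ih)
      (h.κtilde₄_nonneg hP hL0)

lemma scaling_sq (k : ℕ) : P.scaling n dt L0 T k ^ 2 = P.scalingSq n dt L0 T k :=
  Real.sq_sqrt (h.scalingSq_pos hP hL0 k).le

theorem isSchedule : IsSchedule P n T dt L0 (stepsize n dt T) (P.κtilde₄ n dt L0 T)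
    (P.scaling n dt L0 T) where
  α_pos := h.α_pos
  α_le := h.α_le
  pos k := Real.sqrt_pos.2 (h.scalingSq_pos hP hL0 k)
  le k := (Real.sqrt_le_left hP.s₀_pos.le).2 (h.scalingSq_le hP k)
  sq_succ k := by rw [h.scaling_sq hP hL0, h.scaling_sq hP hL0, Params.scalingSq]
  ψ₃_le := h.ψ₃_le
  le_κ := by
    have hC := hP.C_pos
    rw [Params.κtilde₄]
    refine le_of_eq ?_
    field_simp

end IsTuned

lemma sum_scalingSq (k : ℕ) :
    P.ε₈ * ∑ j ∈ Finset.range k, P.scalingSq n dt L0 T j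
      = P.s₀ ^ 2 - P.scalingSq n dt L0 T k + k * P.κtilde₄ n dt L0 T := by
  induction k with
  | zero => simp [Params.scalingSq]
  | succ k ih =>
    rw [Finset.sum_range_succ, mul_add, ih, Params.scalingSq]
    push_cast
    ring

/-- The bound, per agent, for the Lyapunov function along the run, where the initial value per
agent is at most `B` and `κ = κ̂₃`. -/
noncomputable def lyapunovBound (P : Params) (κ B : ℝ) : ℝ :=
  2 * |B| + (P.ψ₂ P.κhat₀ * P.C ^ 2 * P.s₀ ^ 2 / √κ
    + P.ψ₂ P.κhat₀ ^ 2 * P.ψ₄ * P.C ^ 2 * P.s₀ ^ 2) / P.ε₈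

lemma lyapunovBound_nonneg (hP : P.Admissible) (κ B : ℝ) : 0 ≤ lyapunovBound P κ B := by
  have := hP.ψ₂_nonneg hP.κhat₀_pos.le
  have := hP.ψ₄_nonneg
  have := hP.ε₈_pos
  rw [lyapunovBound]
  positivity

namespace IsTuned

variable (h : IsTuned P n T dt L0 κ (stepsize n dt T)) (hP : P.Admissible) (hL0 : 0 ≤ L0)
include h hP hL0

lemma ε₈_mul_sum_scalingSq_le {q : ℝ} (hq : q = (1 - 2 * P.ε₅) * P.ψ₂ (stepsize n dt T)) :
    P.ε₈ * (stepsize n dt T * q * (n * dt ^ 2 * P.C ^ 2)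
        * ∑ j ∈ Finset.range T, P.scalingSq n dt L0 T j)
      ≤ n * (stepsize n dt T * dt ^ 2) * q * (P.C ^ 2 * P.s₀ ^ 2)
        + q * P.ψ₄ * (stepsize n dt T * √(n : ℝ)) * L0
        + n * (q ^ 2 * P.ψ₄ * P.s₀ ^ 2 * P.C ^ 2) := by
  have hC := hP.C_pos
  have hα := h.α_pos
  have hsq := h.sq_mul
  have hnn : (n : ℝ) = √(n : ℝ) ^ 2 := (Real.sq_sqrt n.cast_nonneg).symm
  have hq0 : 0 ≤ q :=
    hq ▸ mul_nonneg hP.one_sub_two_mul_ε₅_nonneg (hP.ψ₂_nonneg hα.le)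
  have hsum : P.ε₈ * ∑ j ∈ Finset.range T, P.scalingSq n dt L0 T j
      ≤ P.s₀ ^ 2 + T * (P.ψ₄ * L0 * stepsize n dt T ^ 2 / P.C ^ 2
        + q * P.ψ₄ * (stepsize n dt T * √(n : ℝ)) * P.s₀ ^ 2) := by
    rw [sum_scalingSq, h.κtilde₄_eq, hq]
    linarith [h.scalingSq_pos hP hL0 T]
  set α := stepsize n dt T
  calc _ = α * q * (n * dt ^ 2 * P.C ^ 2)
          * (P.ε₈ * ∑ j ∈ Finset.range T, P.scalingSq n dt L0 T j) := by ring
    _ ≤ _ := mul_le_mul_of_nonneg_left hsum (by positivity)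
    _ = _ := by
      rw [hnn, Real.sqrt_sq (Real.sqrt_nonneg _)]
      field_simp
      linear_combination (q * √(n : ℝ) * P.ψ₄ * α * L0
        + √(n : ℝ) ^ 2 * q ^ 2 * P.ψ₄ * P.s₀ ^ 2 * P.C ^ 2) * hsq

theorem noise_le (hκ : 0 < κ) {B : ℝ} (hB : L0 ≤ B * n) :
    L0 + stepsize n dt T * P.ψ₂ (stepsize n dt T) * ((1 - 2 * P.ε₅) * (n * dt ^ 2 * P.C ^ 2)
        * ∑ j ∈ Finset.range T, P.scalingSq n dt L0 T j)
      ≤ n * lyapunovBound P κ B := by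
  have hα := h.α_pos
  have hε₈ := hP.ε₈_pos
  have hψ₄ := hP.ψ₄_nonneg
  have hε₅ := hP.one_sub_two_mul_ε₅_nonneg
  have hψ₂ := hP.ψ₂_nonneg hα.le
  have hψ₂_le : P.ψ₂ (stepsize n dt T) ≤ P.ψ₂ P.κhat₀ := hP.ψ₂_mono h.α_le
  have hsum := h.ε₈_mul_sum_scalingSq_le hP hL0 rfl
  have htuned := h.ψ₂_le
  set α := stepsize n dt T
  set q := (1 - 2 * P.ε₅) * P.ψ₂ α
  have : 0 ≤ q := mul_nonneg hε₅ hψ₂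
  have hq : q ≤ P.ψ₂ P.κhat₀ :=
    (mul_le_of_le_one_left hψ₂ (by linarith [hP.ε₅_pos])).trans hψ₂_le
  have hαdt : α * dt ^ 2 ≤ 1 / √κ := by
    rw [le_div_iff₀ (Real.sqrt_pos.2 hκ)]
    refine le_of_sq_le_sq ?_ zero_le_one
    rw [mul_pow, Real.sq_sqrt hκ.le]
    linarith [h.κ_le]
  have hB' : L0 ≤ |B| * n := hB.trans (by gcongr; exact le_abs_self B)
  have hnoise : P.ε₈ * (α * q * (n * dt ^ 2 * P.C ^ 2)
      * ∑ j ∈ Finset.range T, P.scalingSq n dt L0 T j)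
      ≤ P.ε₈ * (n * (lyapunovBound P κ B - |B|)) :=
    calc _ ≤ _ := hsum
      _ ≤ n * (1 / √κ) * P.ψ₂ P.κhat₀ * (P.C ^ 2 * P.s₀ ^ 2) + P.ε₈ * (|B| * n)
          + n * (P.ψ₂ P.κhat₀ ^ 2 * P.ψ₄ * P.s₀ ^ 2 * P.C ^ 2) := by
        gcongr
        linarith
      _ = _ := by
        rw [lyapunovBound]
        field_simp
        ring
  linarith [le_of_mul_le_mul_left hnoise hε₈]

end IsTuned

end Tuning

/-! ### Convergence -/

section Convergence

variable {n d T k : ℕ} {P : Params} {A : Matrix (Fin n) (Fin n) ℝ} {f : Fin n → Vec d → ℝ}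
  {lam flow L0 α κ B M : ℝ} {p : ℝ≥0∞} {Cmp : Vec d → Vec d} {S : AlgState n d} {s : ℕ → ℝ}
  {run : ℕ → AlgState n d} {x0 : Fin n → Vec d}

/-- The quantity `‖∇f(x̄)‖² + (1/n) ∑ᵢ ‖xᵢ - x̄‖²`, which vanishes exactly if all agents agree on
a stationary point. -/
noncomputable def residual (f : Fin n → Vec d → ℝ) (x : Fin n → Vec d) : ℝ :=
  ‖gradient (globalCost f) (mean x)‖ ^ 2 + 1 / (n : ℝ) * consensusError x

/-- The factor between the bound on the Lyapunov function per agent and the constants in the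
rates. -/
noncomputable def rateConst (P : Params) : ℝ :=
  1 + 1 / min (P.φ₁ / 2) (3 / 40) + (2 * P.ell + 1 / P.ε₁) * (2 / P.κhat₀)

lemma one_le_rateConst (hP : P.Admissible) : 1 ≤ rateConst P := by
  have := hP.φ₁_pos
  have := hP.ell_pos
  have := hP.ε₁_pos
  have := hP.κhat₀_pos
  rw [rateConst, add_assoc]
  exact le_add_of_nonneg_right (by positivity)

lemma one_div_min_le_rateConst (hP : P.Admissible) :
    1 / min (P.φ₁ / 2) (3 / 40) ≤ rateConst P := by
  have := hP.ell_pos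
  have := hP.ε₁_pos
  have := hP.κhat₀_pos
  have htermwise : 0 ≤ (2 * P.ell + 1 / P.ε₁) * (2 / P.κhat₀) := by positivity
  rw [rateConst]
  linarith

lemma mul_two_div_le_rateConst (hP : P.Admissible) :
    (2 * P.ell + 1 / P.ε₁) * (2 / P.κhat₀) ≤ rateConst P := by
  have := hP.φ₁_pos
  rw [rateConst]
  exact le_add_of_nonneg_left (by positivity)

lemma mul_consensusError_add_le_lyapunovAt (hP : P.Admissible) (hN : IsNetwork P A f lam)
    (flow : ℝ) (S : AlgState n d) :
    P.ε₁ * consensusError S.x + n * (globalCost f (mean S.x) - flow)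
      ≤ P.lyapunovAt A lam f flow S := by
  have hdual := mul_nonneg hP.ε₁_pos.le (dualError_nonneg hN P.γ S.x S.v)
  linarith [le_lyapunovAt hP hN flow S]

lemma lyapunovAt_nonneg (hP : P.Admissible) (hN : IsNetwork P A f lam)
    (hflow : ∀ x, flow ≤ globalCost f x) (S : AlgState n d) :
    0 ≤ P.lyapunovAt A lam f flow S := by
  have hconsensus := mul_nonneg hP.ε₁_pos.le (consensusError_nonneg S.x)
  have hgap := mul_nonneg (n.cast_nonneg (α := ℝ)) (sub_nonneg.2 (hflow (mean S.x)))
  linarith [mul_consensusError_add_le_lyapunovAt hP hN flow S]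

lemma globalCost_sub_le (hP : P.Admissible) (hN : IsNetwork P A f lam)
    (hS : P.lyapunovAt A lam f flow S ≤ n * M) : globalCost f (mean S.x) - flow ≤ M := by
  have hn : (0 : ℝ) < n := by exact_mod_cast two_pos.trans_le hN.two_le
  have hconsensus := mul_nonneg hP.ε₁_pos.le (consensusError_nonneg S.x)
  refine le_of_mul_le_mul_left ?_ hn
  linarith [mul_consensusError_add_le_lyapunovAt hP hN flow S]

lemma residual_le (hP : P.Admissible) (hN : IsNetwork P A f lam)
    (hflow : ∀ x, flow ≤ globalCost f x) (hS : P.lyapunovAt A lam f flow S ≤ n * M) :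
    residual f S.x ≤ (2 * P.ell + 1 / P.ε₁) * M := by
  have hn : 0 < n := two_pos.trans_le hN.two_le
  have hn' : (0 : ℝ) < n := by exact_mod_cast hn
  have hε₁ := hP.ε₁_pos
  have hell := hP.ell_pos
  obtain ⟨hdiff, hlip⟩ := isSmoothCost_globalCost hn.ne' hN.smooth
  have hgrad : ‖gradient (globalCost f) (mean S.x)‖ ^ 2 ≤ 2 * P.ell * M :=
    (norm_gradient_sq_le hdiff hlip hell hflow _).trans
      (by gcongr; exact globalCost_sub_le hP hN hS)
  have hconsensus : 1 / (n : ℝ) * consensusError S.x ≤ 1 / P.ε₁ * M := by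
    have hgap := mul_nonneg hn'.le (sub_nonneg.2 (hflow (mean S.x)))
    rw [one_div_mul_eq_div, one_div_mul_eq_div, div_le_div_iff₀ hn' hε₁]
    linarith [mul_consensusError_add_le_lyapunovAt hP hN flow S]
  rw [residual]
  linarith

lemma mul_residual_le_decrement {c : ℝ} (hn : 0 < n) (hα : 0 ≤ α) (hc : c ≤ P.φ₁ - α * P.φ₂)
    (hc' : c ≤ 3 / 40) (x : Fin n → Vec d) :
    n * (α * c * residual f x) ≤ P.decrement f α x := by
  have hx := consensusError_nonneg x
  calc n * (α * c * residual f x)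
      = α * c * consensusError x
          + c * α * (n * ‖gradient (globalCost f) (mean x)‖ ^ 2) := by
        rw [residual]
        field_simp
        ring
    _ ≤ _ := by
        rw [Params.decrement]
        gcongr

namespace IsTuned

variable {dt : ℝ}

lemma stepsize_le_one_div (h : IsTuned P n T dt L0 κ (stepsize n dt T)) (hn : 0 < n)
    (hdt : 1 ≤ dt) : stepsize n dt T ≤ 1 / (stepsize n dt T * T) := by
  have hα := h.α_pos
  have hT : (0 : ℝ) < T := by exact_mod_cast h.T_pos
  have hsqrt : 1 ≤ √(n : ℝ) := Real.one_le_sqrt.2 (by exact_mod_cast hn)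
  have hsq : 1 ≤ dt ^ 2 := one_le_pow₀ hdt
  rw [le_div_iff₀ (by positivity), ← h.sq_mul]
  calc _ = stepsize n dt T ^ 2 * (1 * 1 * T) := by ring
    _ ≤ _ := by gcongr

end IsTuned

lemma isTrajectory_algRun (hN : IsNetwork P A f lam) (hp : 1 ≤ p) (hdhat : dHat p d = P.dhat)
    (hflow : ∀ x, flow ≤ globalCost f x) (hCmp : IsLocallyBounded p P.r P.C P.δ Cmp)
    (hx0 : ∀ i, lpNorm p (x0 i) ≤ P.C * s 0) :
    IsTrajectory P p A f lam flow Cmp α s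
      (algRun (laplacian A) f Cmp α P.β P.γ P.ω s x0) where
  network := hN
  one_le_p := hp
  dHat_eq := hdhat
  flow_le := hflow
  locallyBounded := hCmp
  isConsistent_zero := ⟨(map_zero (matAct (laplacian A))).symm, by simp [mean, algRun]⟩
  inRange_zero i := by simpa only [algRun, sub_zero] using hx0 i
  succ _ := rfl

namespace IsTrajectory

variable (hr : IsTrajectory P p A f lam flow Cmp (stepsize n (dTilde p d) T)
    (P.scaling n (dTilde p d) L0 T) run)
  (hP : P.Admissible) (h : IsTuned P n T (dTilde p d) L0 κ (stepsize n (dTilde p d) T))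
  (h0 : P.lyapunovAt A lam f flow (run 0) = L0) (hκ : 0 < κ) (hB : L0 ≤ B * n)
include hr hP h h0 hκ hB

theorem lyapunovAt_add_sum_decrement_le_lyapunovBound (hk : k ≤ T) :
    P.lyapunovAt A lam f flow (run k)
        + ∑ j ∈ Finset.range k, P.decrement f (stepsize n (dTilde p d) T) (run j).x
      ≤ n * lyapunovBound P κ B := by
  have hL0 : 0 ≤ L0 := h0 ▸ lyapunovAt_nonneg hP hr.network hr.flow_le _
  have hs := h.isSchedule hP hL0
  have hα := h.α_pos.le
  have hψ₂ := hP.ψ₂_nonneg hα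
  have hε₅ := hP.one_sub_two_mul_ε₅_nonneg
  refine (hr.lyapunovAt_add_sum_decrement_le hP hs h0.le fun j hj =>
    hr.inRange hP hs h0.le (hj.le.trans hk)).trans (le_trans ?_ (h.noise_le hP hL0 hκ hB))
  simp only [h.scaling_sq hP hL0]
  gcongr
  exact fun j _ _ => (h.scalingSq_pos hP hL0 j).le

lemma lyapunovAt_le (hk : k ≤ T) :
    P.lyapunovAt A lam f flow (run k) ≤ n * lyapunovBound P κ B :=
  (le_add_of_nonneg_right (Finset.sum_nonneg fun _ _ =>
    decrement_nonneg hP h.α_pos.le h.α_le _)).trans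
    (hr.lyapunovAt_add_sum_decrement_le_lyapunovBound hP h h0 hκ hB hk)

theorem sum_residual_le_of_le {c : ℝ} (hc : 0 < c)
    (hcφ : c ≤ P.φ₁ - stepsize n (dTilde p d) T * P.φ₂) (hc' : c ≤ 3 / 40) :
    ∑ k ∈ Finset.range T, residual f (run k).x
      ≤ lyapunovBound P κ B * (1 / c) * (1 / stepsize n (dTilde p d) T) := by
  have hn : 0 < n := two_pos.trans_le hr.network.two_le
  have hn' : (0 : ℝ) < n := by exact_mod_cast hn
  have hα := h.α_pos
  have hV := lyapunovAt_nonneg hP hr.network hr.flow_le (run T)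
  have hsum : n * (stepsize n (dTilde p d) T * c * ∑ k ∈ Finset.range T, residual f (run k).x)
      ≤ n * lyapunovBound P κ B :=
    calc _ = ∑ k ∈ Finset.range T,
            n * (stepsize n (dTilde p d) T * c * residual f (run k).x) := by
          rw [Finset.mul_sum, Finset.mul_sum]
      _ ≤ ∑ k ∈ Finset.range T, P.decrement f (stepsize n (dTilde p d) T) (run k).x :=
          Finset.sum_le_sum fun k _ => mul_residual_le_decrement hn hα.le hcφ hc' _
      _ ≤ _ := (le_add_of_nonneg_left hV).trans
          (hr.lyapunovAt_add_sum_decrement_le_lyapunovBound hP h h0 hκ hB le_rfl)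
  calc _ ≤ lyapunovBound P κ B / (stepsize n (dTilde p d) T * c) := by
        rw [le_div_iff₀ (mul_pos hα hc), mul_comm]
        exact le_of_mul_le_mul_left hsum hn'
    _ = _ := by field_simp

lemma sum_residual_le :
    ∑ k ∈ Finset.range T, residual f (run k).x
      ≤ T * ((2 * P.ell + 1 / P.ε₁) * lyapunovBound P κ B) :=
  calc _ ≤ ∑ _k ∈ Finset.range T, (2 * P.ell + 1 / P.ε₁) * lyapunovBound P κ B :=
        Finset.sum_le_sum fun k hk => residual_le hP hr.network hr.flow_le
          (hr.lyapunovAt_le hP h h0 hκ hB (Finset.mem_range.1 hk).le)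
    _ = _ := by rw [Finset.sum_const, Finset.card_range, nsmul_eq_mul]

theorem average_residual_le (hd : 1 ≤ d) :
    1 / (T : ℝ) * ∑ k ∈ Finset.range T, residual f (run k).x
      ≤ lyapunovBound P κ B * rateConst P * (1 / (stepsize n (dTilde p d) T * T)) := by
  have hT : (0 : ℝ) < T := by exact_mod_cast h.T_pos
  have hα := h.α_pos
  have hκ₀ := hP.κhat₀_pos
  have hell := hP.ell_pos
  have hε₁ := hP.ε₁_pos
  have hφ₁ := hP.φ₁_pos
  have hM := lyapunovBound_nonneg hP κ B
  have hαT := h.stepsize_le_one_div (two_pos.trans_le hr.network.two_le) (one_le_dTilde hd)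
  set α := stepsize n (dTilde p d) T
  -- The coefficient `φ₁ - α φ₂` of the consensus error in the descent inequality degenerates as
  -- `α` approaches `κ̂₀`; but then `1 / (α T) ≥ α ≥ κ̂₀ / 2`, and a bound on each term is enough.
  rcases le_total α (P.κhat₀ / 2) with hsmall | hlarge
  · have hφ : P.φ₁ / 2 ≤ P.φ₁ - α * P.φ₂ := by
      linarith [mul_le_mul_of_nonneg_right hsmall hP.φ₂_pos.le, hP.mul_φ₂_le le_rfl]
    calc _ ≤ 1 / (T : ℝ) * (lyapunovBound P κ B * (1 / min (P.φ₁ / 2) (3 / 40)) * (1 / α)) := by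
          gcongr
          exact hr.sum_residual_le_of_le hP h h0 hκ hB (by positivity)
            ((min_le_left _ _).trans hφ) (min_le_right _ _)
      _ = lyapunovBound P κ B * (1 / min (P.φ₁ / 2) (3 / 40)) * (1 / (α * T)) := by field_simp
      _ ≤ _ := by
          gcongr
          exact one_div_min_le_rateConst hP
  · calc _ ≤ 1 / (T : ℝ) * (T * ((2 * P.ell + 1 / P.ε₁) * lyapunovBound P κ B)) := by
          gcongr
          exact hr.sum_residual_le hP h h0 hκ hB
      _ = lyapunovBound P κ B * ((2 * P.ell + 1 / P.ε₁) * (2 / P.κhat₀)) * (P.κhat₀ / 2) := by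
          field_simp
      _ ≤ _ := by
          have := one_le_rateConst hP
          refine mul_le_mul ?_ (hlarge.trans hαT) (by positivity) (by positivity)
          gcongr
          exact mul_two_div_le_rateConst hP

end IsTrajectory

end Convergence

end DistOpt

theorem theorem1 (P : Params) (κhat₃ B : ℝ)
    (hell : 0 < P.ell) (hr : 0 < P.r) (hC : 0 < P.C) (hδ : 0 < P.δ ∧ P.δ ≤ 1)
    (hω : 0 < P.ω ∧ P.ω ≤ 1 / P.r) (hs₀ : 0 < P.s₀)
    (hτ₁ : P.κ₁ ≤ P.τ₁) (hγ : P.κ₂ < P.γ) (hκhat₀ : 0 < P.κhat₀) (hκhat₃ : 0 < κhat₃) :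
    ∃ M : ℝ, ∀ (n d T : ℕ) (p : ENNReal) (A : Matrix (Fin n) (Fin n) ℝ)
      (Cmp : Vec d → Vec d) (f : Fin n → Vec d → ℝ) (flow lam : ℝ) (x0 : Fin n → Vec d)
      (L0 : ℝ) (run : ℕ → AlgState n d),
      2 ≤ n → 1 ≤ d → 1 ≤ p → dHat p d = P.dhat →
      IsLocallyBounded p P.r P.C P.δ Cmp →
      IsUndirectedConnected A →
      rhoMax (laplacian A) = P.rho → rhoTwo (laplacian A) = P.rho2 →
      lam ∈ Set.Icc P.rho2 P.rho →
      (∀ i, IsSmoothCost P.ell (f i)) →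
      BddBelow (Set.range (globalCost f)) →
      flow ≤ ⨅ x, globalCost f x →
      (∀ i, lpNorm p (x0 i) / P.C ≤ P.s₀) →
      L0 = lyapunov (laplacian A) lam f P.β P.γ flow x0 (fun _ => 0) →
      L0 ≤ B * n →
      P.κtilde₃ n (dTilde p d) κhat₃ L0 T < T →
      run = algRun (laplacian A) f Cmp (stepsize n (dTilde p d) T) P.β P.γ P.ω
        (P.scaling n (dTilde p d) L0 T) x0 →
      (1 / (T : ℝ)) * ∑ k ∈ Finset.range T,
          (‖gradient (globalCost f) (mean (run k).x)‖ ^ 2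
            + (1 / (n : ℝ)) * ∑ i, ‖(run k).x i - mean (run k).x‖ ^ 2)
        ≤ M * ((n : ℝ) ^ (1 / 4 : ℝ) * dTilde p d / √(T : ℝ))
      ∧ globalCost f (mean (run T).x) - ⨅ x, globalCost f x ≤ M := by
  refine ⟨lyapunovBound P κhat₃ B * rateConst P, ?_⟩
  intro n d T p A Cmp f flow lam x0 L0 run hn hd hp hdhat hCmp hA hρ hρ₂ hlam hf hbdd hflow hx0
    hL0 hB hT hrun
  have hP : P.Admissible := ⟨hell, hr, hC, hδ.1, hδ.2, hω.1, hω.2, hs₀, hτ₁, hγ, hκhat₀,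
    hρ₂ ▸ hA.rhoTwo_pos hn, hlam.1.trans hlam.2⟩
  have hN : IsNetwork P A f lam := ⟨hn, hA, hρ, hρ₂, hlam, hf⟩
  have hdt : 0 < dTilde p d := one_pos.trans_le (one_le_dTilde hd)
  have htuned := isTuned_stepsize hP (two_pos.trans_le hn) hdt hκhat₃ hT
  have hscale : P.scaling n (dTilde p d) L0 T 0 = P.s₀ := Real.sqrt_sq hs₀.le
  have htraj : IsTrajectory P p A f lam flow Cmp _ _ run := hrun ▸ isTrajectory_algRun hN hp hdhat
    (fun x => hflow.trans (ciInf_le hbdd x)) hCmp fun i => by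
      rw [hscale, mul_comm]
      exact (div_le_iff₀ hC).1 (hx0 i)
  have hinit : P.lyapunovAt A lam f flow (run 0) = L0 := by rw [hrun, hL0]; rfl
  constructor
  · rw [rate_eq_one_div_stepsize_mul (two_pos.trans_le hn) hdt htuned.T_pos]
    exact htraj.average_residual_le hP htuned hinit hκhat₃ hB hd
  · have hgap : globalCost f (mean (run T).x) - flow ≤ lyapunovBound P κhat₃ B :=
      globalCost_sub_le hP hN (htraj.lyapunovAt_le hP htuned hinit hκhat₃ hB le_rfl)
    have hM := le_mul_of_one_le_right (lyapunovBound_nonneg hP κhat₃ B) (one_le_rateConst hP)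
    linarith
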